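/- Let $I,J,U\subseteq\mathbb R$ be intervals with non-empty interior (the ranges of $t$, $x$, $u$), and consider the equation $$u_t=[G(x)A(u)u_x]_x+W(t),\qquad t\in I,\ x\in J,\ u\in U, \qquad (*)$$ where $G,A,W$ are smooth on $J,U,I$ respectively, $G$ vanishes nowhere on $J$, and $(*)$ is nonlinear, i.e. $A$ is not constant on $U$; assume also that the set where $A\neq0$ is dense in $U$, so that $(*)$ does not degenerate (this is automatic if $A$ is analytic and not constant). A differential function is a smooth function of $t$, $x$ and finitely many derivatives of $u$ (including $u$ itself); $D_t$, $D_x$ are the total derivatives. A conserved vector of $(*)$ is a pair $(T,X)$ of differential functions, of any finite order, such that $D_tT+D_xX=0$ on the solution manifold of $(*)$, i.e. at all points of the infinite jet space at which $(*)$ and all its differential consequences hold. A conserved vector is trivial if it is the sum of a pair of differential functions that vanish on the solution manifold and of a pair $(\check T,\check X)$ of differential functions with $D_t\check T+D_x\check X\equiv0$ identically. The space of (local) conservation laws of $(*)$ is the quotient of the vector space of conserved vectors by the subspace of trivial ones. Then the space of conservation laws of $(*)$ has dimension exactly two: for any choice of the antiderivatives $\int W\,dt$ on $I$, $\int dx/G$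 on $J$ and $\int A\,du$ on $U$, the pairs $$T=u-\int W\,dt,\qquad X=-GAu_x,$$ $$T=\Big(u-\int W\,dt\Big)\int\frac{dx}{G},\qquad X=-GAu_x\int\frac{dx}{G}+\int A\,du$$ are conserved vectors of $(*)$, and the two conservation laws they represent form a basis of this space. -/

import Mathlib

open scoped ContDiff

noncomputable section

namespace LocalCL

/-- Coordinates of the infinite jet space over the `(t, x)`-plane with one dependent variable `u`:
`u i j` stands for the derivative `∂ₜ^i ∂ₓ^j u`, so that `u 0 0` is `u` itself. -/
inductive JetCoord : Type
  | t : JetCoord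
  | x : JetCoord
  | u (i j : ℕ) : JetCoord
  deriving DecidableEq

/-- A point of the infinite jet space. -/
abbrev Jet : Type := JetCoord → ℝ

/-- Ranges of the coordinates: `t ∈ I`, `x ∈ J`, `u ∈ U`; the derivatives of `u` are
unrestricted. -/
def range (I J U : Set ℝ) : JetCoord → Set ℝ
  | .t => I
  | .x => J
  | .u 0 0 => U
  | .u _ _ => Set.univ

/-- The part of the jet space in which every coordinate `c` lies in its range `B c`. -/
def jetDomain (B : JetCoord → Set ℝ) : Set Jet := {z | ∀ c, z c ∈ B c}

/-- Differential functions: on the jet domain, `F` is a smooth function of finitely many jet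
coordinates (equivalently, of `t`, `x` and the derivatives of `u` up to some finite order). -/
def IsDiffFun (B : JetCoord → Set ℝ) (F : Jet → ℝ) : Prop :=
  ∃ (s : Finset JetCoord) (f : (s → ℝ) → ℝ),
    ContDiffOn ℝ ∞ f {y | ∀ c : s, y c ∈ B c} ∧
    ∀ z ∈ jetDomain B, F z = f (fun c : s => z c)

/-- Partial derivative of `F` with respect to the jet coordinate `c` (one-sided at an end point of
the range of `c`, if that end point belongs to the range). -/
def pderiv (B : JetCoord → Set ℝ) (c : JetCoord) (F : Jet → ℝ) : Jet → ℝ :=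
  fun z => derivWithin (fun s : ℝ => F (Function.update z c s)) (B c) (z c)

/-- Total derivative with respect to `t`:
`D_t = ∂_t + ∑ u_{i+1,j} ∂_{u_{i,j}}`; for a differential function the sum is finite. -/
def totalDt (B : JetCoord → Set ℝ) (F : Jet → ℝ) : Jet → ℝ :=
  fun z => pderiv B .t F z + ∑ᶠ p : ℕ × ℕ, z (.u (p.1 + 1) p.2) * pderiv B (.u p.1 p.2) F z

/-- Total derivative with respect to `x`:
`D_x = ∂_x + ∑ u_{i,j+1} ∂_{u_{i,j}}`; for a differential function the sum is finite. -/
def totalDx (B : JetCoord → Set ℝ) (F : Jet → ℝ) : Jet → ℝ :=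
  fun z => pderiv B .x F z + ∑ᶠ p : ℕ × ℕ, z (.u p.1 (p.2 + 1)) * pderiv B (.u p.1 p.2) F z

/-- Total divergence `D_t T + D_x X` of the pair `F = (T, X)`. -/
def totalDiv (B : JetCoord → Set ℝ) (F : (Jet → ℝ) × (Jet → ℝ)) : Jet → ℝ :=
  fun z => totalDt B F.1 z + totalDx B F.2 z

/-- The solution manifold of the equation `E = 0` in the jet space: the equation holds together
with all its differential consequences `D_t^i D_x^j E = 0`. -/
def solManifold (B : JetCoord → Set ℝ) (E : Jet → ℝ) : Set Jet :=
  {z | z ∈ jetDomain B ∧ ∀ i j : ℕ, ((totalDt B)^[i] ((totalDx B)^[j] E)) z = 0}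

section Linearity

variable {B : JetCoord → Set ℝ} {F F' : Jet → ℝ}

theorem IsDiffFun.zero : IsDiffFun B (0 : Jet → ℝ) :=
  ⟨∅, fun _ => 0, contDiffOn_const, fun _ _ => rfl⟩

theorem IsDiffFun.smul (a : ℝ) (hF : IsDiffFun B F) : IsDiffFun B (a • F) := by
  obtain ⟨s, f, hf, h⟩ := hF
  exact ⟨s, fun y => a * f y, contDiffOn_const.mul hf, fun z hz => by simp [h z hz]⟩

theorem IsDiffFun.add (hF : IsDiffFun B F) (hF' : IsDiffFun B F') : IsDiffFun B (F + F') := by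
  obtain ⟨s, f, hf, h⟩ := hF
  obtain ⟨s', f', hf', h'⟩ := hF'
  refine ⟨s ∪ s', fun y => f (fun c => y ⟨c, Finset.mem_union_left _ c.2⟩)
    + f' (fun c => y ⟨c, Finset.mem_union_right _ c.2⟩), ?_, fun z hz => by simp [h z hz, h' z hz]⟩
  refine ContDiffOn.add (hf.comp (t := {y | ∀ c : s, y c ∈ B c})
      (ContDiff.contDiffOn (contDiff_pi.2 fun c => contDiff_apply ℝ ℝ _)) ?_)
    (hf'.comp (t := {y | ∀ c : s', y c ∈ B c})
      (ContDiff.contDiffOn (contDiff_pi.2 fun c => contDiff_apply ℝ ℝ _)) ?_)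
  · exact fun y hy c => hy ⟨c, Finset.mem_union_left _ c.2⟩
  · exact fun y hy c => hy ⟨c, Finset.mem_union_right _ c.2⟩

theorem update_mem {z : Jet} (hz : z ∈ jetDomain B) {c : JetCoord} {s : ℝ} (hs : s ∈ B c) :
    Function.update z c s ∈ jetDomain B := by
  intro d
  by_cases hd : d = c
  · subst hd; simpa using hs
  · simpa [hd] using hz d

theorem IsDiffFun.differentiableWithinAt (hF : IsDiffFun B F) {z : Jet} (hz : z ∈ jetDomain B)
    (c : JetCoord) :
    DifferentiableWithinAt ℝ (fun s : ℝ => F (Function.update z c s)) (B c) (z c) := by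
  obtain ⟨s, f, hf, h⟩ := hF
  have h1 : DifferentiableOn ℝ (fun r : ℝ => f (fun d : s => Function.update z c r d)) (B c) := by
    refine (hf.differentiableOn (by simp)).comp (Differentiable.differentiableOn ?_) ?_
    · refine differentiable_pi.2 fun d => ?_
      by_cases hd : (d : JetCoord) = c
      · simp [Function.update, hd]
      · simp [Function.update, hd]
    · intro r hr d
      exact update_mem hz hr _
  exact (h1 _ (hz c)).congr (fun r hr => h _ (update_mem hz hr)) (h _ (update_mem hz (hz c)))

theorem IsDiffFun.finite_support (hF : IsDiffFun B F) {z : Jet} (hz : z ∈ jetDomain B)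
    (w : ℕ × ℕ → ℝ) :
    (Function.support fun p : ℕ × ℕ => w p * pderiv B (.u p.1 p.2) F z).Finite := by
  obtain ⟨s, f, -, h⟩ := hF
  have hinj : Function.Injective fun p : ℕ × ℕ => JetCoord.u p.1 p.2 := by
    rintro ⟨a, b⟩ ⟨c, d⟩ h
    simpa using h
  refine (s.finite_toSet.preimage hinj.injOn).subset fun p hp => ?_
  by_contra hps
  have hps' : JetCoord.u p.1 p.2 ∉ s := hps
  refine hp ?_
  have hc : ∀ r ∈ B (.u p.1 p.2), F (Function.update z (.u p.1 p.2) r) = f (fun c : s => z c) := by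
    intro r hr
    rw [h _ (update_mem hz hr)]
    congr 1
    funext c
    have hne : (c : JetCoord) ≠ .u p.1 p.2 := fun e => hps' (e ▸ c.2)
    simp [hne]
  have : pderiv B (.u p.1 p.2) F z = 0 := by
    unfold pderiv
    rw [derivWithin_congr hc (hc _ (hz _))]
    simp
  simp [this]

theorem pderiv_add (hF : IsDiffFun B F) (hF' : IsDiffFun B F') {z : Jet} (hz : z ∈ jetDomain B)
    (c : JetCoord) : pderiv B c (F + F') z = pderiv B c F z + pderiv B c F' z :=
  derivWithin_fun_add (hF.differentiableWithinAt hz c) (hF'.differentiableWithinAt hz c)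

theorem pderiv_smul (a : ℝ) (hF : IsDiffFun B F) {z : Jet} (hz : z ∈ jetDomain B)
    (c : JetCoord) : pderiv B c (a • F) z = a * pderiv B c F z :=
  derivWithin_const_mul a (hF.differentiableWithinAt hz c)

theorem totalDt_add (hF : IsDiffFun B F) (hF' : IsDiffFun B F') {z : Jet}
    (hz : z ∈ jetDomain B) : totalDt B (F + F') z = totalDt B F z + totalDt B F' z := by
  simp only [totalDt, pderiv_add hF hF' hz, mul_add]
  rw [finsum_add_distrib (hF.finite_support hz _) (hF'.finite_support hz _)]
  ring

theorem totalDx_add (hF : IsDiffFun B F) (hF' : IsDiffFun B F') {z : Jet}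
    (hz : z ∈ jetDomain B) : totalDx B (F + F') z = totalDx B F z + totalDx B F' z := by
  simp only [totalDx, pderiv_add hF hF' hz, mul_add]
  rw [finsum_add_distrib (hF.finite_support hz _) (hF'.finite_support hz _)]
  ring

theorem totalDt_smul (a : ℝ) (hF : IsDiffFun B F) {z : Jet}
    (hz : z ∈ jetDomain B) : totalDt B (a • F) z = a * totalDt B F z := by
  simp only [totalDt, pderiv_smul a hF hz, mul_add, mul_left_comm _ a]
  rw [← smul_eq_mul a (finsum _), smul_finsum' a (hF.finite_support hz _)]
  rfl

theorem totalDx_smul (a : ℝ) (hF : IsDiffFun B F) {z : Jet}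
    (hz : z ∈ jetDomain B) : totalDx B (a • F) z = a * totalDx B F z := by
  simp only [totalDx, pderiv_smul a hF hz, mul_add, mul_left_comm _ a]
  rw [← smul_eq_mul a (finsum _), smul_finsum' a (hF.finite_support hz _)]
  rfl

theorem totalDiv_zero (z : Jet) : totalDiv B 0 z = 0 := by
  simp [totalDiv, totalDt, totalDx, pderiv]

end Linearity

/-- Conserved vectors of the equation `E = 0`: pairs `F = (T, X)` of differential functions
(of arbitrary finite order) whose total divergence vanishes on the solution manifold. -/
def CV (B : JetCoord → Set ℝ) (E : Jet → ℝ) : Submodule ℝ ((Jet → ℝ) × (Jet → ℝ)) where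
  carrier := {F | IsDiffFun B F.1 ∧ IsDiffFun B F.2 ∧ ∀ z ∈ solManifold B E, totalDiv B F z = 0}
  zero_mem' := ⟨IsDiffFun.zero, IsDiffFun.zero, fun z _ => totalDiv_zero z⟩
  add_mem' := by
    rintro F F' ⟨h1, h2, h⟩ ⟨h1', h2', h'⟩
    refine ⟨h1.add h1', h2.add h2', fun z hz => ?_⟩
    have e := h z hz
    have e' := h' z hz
    simp only [totalDiv, Prod.fst_add, Prod.snd_add, totalDt_add h1 h1' hz.1,
      totalDx_add h2 h2' hz.1] at e e' ⊢
    linarith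
  smul_mem' := by
    rintro a F ⟨h1, h2, h⟩
    refine ⟨h1.smul a, h2.smul a, fun z hz => ?_⟩
    have e := h z hz
    simp only [totalDiv, Prod.smul_fst, Prod.smul_snd, totalDt_smul a h1 hz.1,
      totalDx_smul a h2 hz.1] at e ⊢
    rw [← mul_add, e, mul_zero]

/-- A pair of differential functions both of which vanish on the solution manifold. -/
def VanishesOnSol (B : JetCoord → Set ℝ) (E : Jet → ℝ) (F : (Jet → ℝ) × (Jet → ℝ)) : Prop :=
  IsDiffFun B F.1 ∧ IsDiffFun B F.2 ∧ ∀ z ∈ solManifold B E, F.1 z = 0 ∧ F.2 z = 0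

/-- A null divergence: a pair of differential functions whose total divergence vanishes
identically. -/
def IsNullDiv (B : JetCoord → Set ℝ) (F : (Jet → ℝ) × (Jet → ℝ)) : Prop :=
  IsDiffFun B F.1 ∧ IsDiffFun B F.2 ∧ ∀ z ∈ jetDomain B, totalDiv B F z = 0

/-- Trivial conserved vectors: sums of a pair vanishing on the solution manifold and a null
divergence. -/
def CV₀ (B : JetCoord → Set ℝ) (E : Jet → ℝ) : Submodule ℝ (CV B E) where
  carrier := {F | ∃ P Q : (Jet → ℝ) × (Jet → ℝ),
    VanishesOnSol B E P ∧ IsNullDiv B Q ∧ (F : (Jet → ℝ) × (Jet → ℝ)) = P + Q}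
  zero_mem' := ⟨0, 0, ⟨IsDiffFun.zero, IsDiffFun.zero, fun _ _ => ⟨rfl, rfl⟩⟩,
    ⟨IsDiffFun.zero, IsDiffFun.zero, fun z _ => totalDiv_zero z⟩, by simp⟩
  add_mem' := by
    rintro F F' ⟨P, Q, ⟨hP1, hP2, hP⟩, ⟨hQ1, hQ2, hQ⟩, hF⟩
      ⟨P', Q', ⟨hP1', hP2', hP'⟩, ⟨hQ1', hQ2', hQ'⟩, hF'⟩
    refine ⟨P + P', Q + Q', ⟨hP1.add hP1', hP2.add hP2', fun z hz => ?_⟩,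
      ⟨hQ1.add hQ1', hQ2.add hQ2', fun z hz => ?_⟩, ?_⟩
    · simp [hP z hz, hP' z hz]
    · have e := hQ z hz
      have e' := hQ' z hz
      simp only [totalDiv, Prod.fst_add, Prod.snd_add, totalDt_add hQ1 hQ1' hz,
        totalDx_add hQ2 hQ2' hz] at e e' ⊢
      linarith
    · rw [Submodule.coe_add, hF, hF']
      abel
  smul_mem' := by
    rintro a F ⟨P, Q, ⟨hP1, hP2, hP⟩, ⟨hQ1, hQ2, hQ⟩, hF⟩
    refine ⟨a • P, a • Q, ⟨hP1.smul a, hP2.smul a, fun z hz => ?_⟩,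
      ⟨hQ1.smul a, hQ2.smul a, fun z hz => ?_⟩, ?_⟩
    · simp [hP z hz]
    · have e := hQ z hz
      simp only [totalDiv, Prod.smul_fst, Prod.smul_snd, totalDt_smul a hQ1 hz,
        totalDx_smul a hQ2 hz] at e ⊢
      rw [← mul_add, e, mul_zero]
    · rw [Submodule.coe_smul, hF, smul_add]

/-- The space of conservation laws of `E = 0`: conserved vectors modulo trivial ones. -/
abbrev CL (B : JetCoord → Set ℝ) (E : Jet → ℝ) : Type := CV B E ⧸ CV₀ B E

/-- The conservation law represented by a conserved vector. -/
def CL.mk {B : JetCoord → Set ℝ} {E : Jet → ℝ} {F : (Jet → ℝ) × (Jet → ℝ)} (h : F ∈ CV B E) :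
    CL B E :=
  Submodule.Quotient.mk ⟨F, h⟩

/-- Left-hand side of the equation `u_t - [G(x) A(u) u_x]_x - W(t) = 0`. -/
def diffusionEq (B : JetCoord → Set ℝ) (G A W : ℝ → ℝ) : Jet → ℝ :=
  fun z => z (.u 1 0)
    - totalDx B (fun y => G (y .x) * A (y (.u 0 0)) * y (.u 0 1)) z - W (z .t)

/-- `P` is an antiderivative of `f` on the interval `s`. -/
def IsAntideriv (P f : ℝ → ℝ) (s : Set ℝ) : Prop :=
  ∀ y ∈ s, HasDerivWithinAt P (f y) s y

/-- The pair `T = u - ∫ W dt`, `X = -G A u_x`, with `S = ∫ W dt`. -/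
def vec₁ (G A S : ℝ → ℝ) : (Jet → ℝ) × (Jet → ℝ) :=
  (fun z => z (.u 0 0) - S (z .t),
   fun z => -(G (z .x) * A (z (.u 0 0)) * z (.u 0 1)))

/-- The pair `T = (u - ∫ W dt) ∫ dx/G`, `X = -G A u_x ∫ dx/G + ∫ A du`, with `S = ∫ W dt`,
`R = ∫ dx/G` and `P = ∫ A du`. -/
def vec₂ (G A S R P : ℝ → ℝ) : (Jet → ℝ) × (Jet → ℝ) :=
  (fun z => (z (.u 0 0) - S (z .t)) * R (z .x),
   fun z => -(G (z .x) * A (z (.u 0 0)) * z (.u 0 1)) * R (z .x) + P (z (.u 0 0)))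

end LocalCL

end

/-!
Differential functions, regarded as functions on the jet domain, form a commutative algebra
`DiffAlg B`. It carries the commuting derivations `pd c = ∂/∂c`, one for each jet coordinate `c`,
and the total derivatives `Dt`, `Dx`, which commute with each other. All of the analysis goes into
this algebra: smoothness is understood up to the end points of the intervals, partial derivatives
commute there, the chain rule holds for substitutions (`Subst.pd_pull`), every differential
function has an antiderivative in each coordinate (`exists_antideriv`), and a function whose
derivative in some coordinates vanishes does not depend on them (`eq_of_pd_eq_zero`). The rest is
differential algebra.

The equation `u_t = K`, with `K = (G A u_x)_x + W`, is solved for `u_t`, whether or not `A` has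
zeros. Hence the derivatives of `u` that involve `t` can be eliminated, which gives a retraction of
the jet domain onto the solution manifold. Substitution along the retraction is `(retr K).pull`, and
a differential function vanishes on the solution manifold exactly if this substitution kills it
(`vanishes_iff`). As the total derivatives are tangent to the manifold (`Dx_retr_pull`,
`retr_pull_Dt`), every conserved vector may be replaced by one that involves only `t`, `x` and
`u_j = ∂ₓ^j u`.

*The two conservation laws span.* Let the density `T` have order `k` in `x`. Then the equation
`∂ₜT + ∑ⱼ (D_x^j K) ∂T/∂u_j + D_x X = 0` forces `∂X/∂u_{k+1} = -G A ∂T/∂u_k`, and its part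
quadratic in `u_{k+1}` yields `G A ∂²T/∂u_k² = 0`. As `A ≠ 0` on a dense set, `T` is affine in `u_k`
(`pd_pd_density`). For `k ≥ 1`, choose `H` with `∂H/∂u_{k-1} = ∂T/∂u_k`; the null divergence
`(D_x H, -D_t H)` can then be subtracted and lowers the order (`isSpanned_of_order`). For `k = 0`,
the coefficient `α(t, x)` of `u` in `T` satisfies `α_t + (G α_x)_x A(u) = 0`. Since `A` is not
constant, `α_t = 0` and `G α_x` is constant, so that `α = c₁ + c₂ ∫ dx/G`. Subtracting the
corresponding combination of the two basic vectors leaves a pair that depends on `t` and `x` alone,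
and this is a null divergence (`isSpanned_of_order_zero`).

*They are independent.* Let `δ_i = ∑ⱼ (-D_x)^j ∂/∂u_{i,j}`. If `D_t Q₁ + D_x Q₂ = 0` identically,
then applying `δ_{i+1}` gives `D_t δ_{i+1} Q₁ + δ_i Q₁ = 0`, so that all `δ_i Q₁` vanish by
descending induction (`exists_euler_eq_zero_of_null`). By the chain rule, `δ_0` then annihilates
the restriction of `Q₁` to the solution manifold (`exists_euler_retr_pull`), whereas it maps the
density `(c₁ + c₂ ∫ dx/G) (u - ∫ W dt)` to `c₁ + c₂ ∫ dx/G` (`eq_zero_of_trivial`).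
-/

noncomputable section

namespace LocalCL

/-! ### Smoothness of parametric integrals up to the boundary -/

section ParametricIntegral

open MeasureTheory Set Filter Topology

theorem intervalIntegrable_slice {E F : Type} [TopologicalSpace E] [NormedAddCommGroup F]
    {Q : Set E} {g : E × ℝ → F}
    (hg : ContinuousOn g (Q ×ˢ Icc (0 : ℝ) 1)) {y : E} (hy : y ∈ Q) :
    IntervalIntegrable (fun τ => g (y, τ)) volume 0 1 := by
  apply ContinuousOn.intervalIntegrable
  rw [uIcc_of_le zero_le_one]
  exact hg.comp (by fun_prop) fun τ hτ => ⟨hy, hτ⟩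

variable {E F : Type} [NormedAddCommGroup E] [NormedSpace ℝ E] [NormedAddCommGroup F]
  [NormedSpace ℝ F]

theorem hasFDerivWithinAt_intervalIntegral [CompleteSpace F] {Q : Set E} (hQ : Convex ℝ Q)
    {g : E × ℝ → F} {D : E × ℝ → E →L[ℝ] F} (hgc : ContinuousOn g (Q ×ˢ Icc (0 : ℝ) 1))
    (hD : ContinuousOn D (Q ×ˢ Icc (0 : ℝ) 1))
    (hgD : ∀ y ∈ Q, ∀ τ ∈ Icc (0 : ℝ) 1, HasFDerivWithinAt (fun y => g (y, τ)) (D (y, τ)) Q y)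
    {y₀ : E} (hy₀ : y₀ ∈ Q) :
    HasFDerivWithinAt (fun y => ∫ τ in (0 : ℝ)..1, g (y, τ)) (∫ τ in (0 : ℝ)..1, D (y₀, τ))
      Q y₀ := by
  rw [hasFDerivWithinAt_iff_isLittleO, Asymptotics.isLittleO_iff]
  intro ε hε
  obtain ⟨v, hv, hvD⟩ := (isCompact_Icc (a := (0 : ℝ)) (b := 1)).mem_uniformity_of_prod
    (f := fun y τ => D (y, τ)) (s := Q) hD hy₀ (Metric.dist_mem_uniformity hε)
  obtain ⟨δ, hδ, hball⟩ := Metric.mem_nhdsWithin_iff.1 hv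
  filter_upwards [inter_mem_nhdsWithin Q (Metric.ball_mem_nhds y₀ hδ)] with y hy
  have hmv : ∀ τ ∈ Icc (0 : ℝ) 1,
      ‖g (y, τ) - g (y₀, τ) - D (y₀, τ) (y - y₀)‖ ≤ ε * ‖y - y₀‖ := by
    intro τ hτ
    refine Convex.norm_image_sub_le_of_norm_hasFDerivWithin_le' (s := Q ∩ Metric.ball y₀ δ)
      (f := fun y => g (y, τ)) (f' := fun y => D (y, τ))
      (fun x hx => (hgD x hx.1 τ hτ).mono inter_subset_left) (fun x hx => ?_)
      (hQ.inter (convex_ball _ _)) ⟨hy₀, Metric.mem_ball_self hδ⟩ hy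
    have := hvD x (hball ⟨hx.2, hx.1⟩) τ hτ
    rw [← dist_eq_norm]
    exact le_of_lt this
  have hi := intervalIntegrable_slice hgc hy.1
  have hi₀ := intervalIntegrable_slice hgc hy₀
  have hiD := intervalIntegrable_slice hD hy₀
  have happ : (∫ τ in (0 : ℝ)..1, D (y₀, τ)) (y - y₀)
      = ∫ τ in (0 : ℝ)..1, D (y₀, τ) (y - y₀) :=
    ContinuousLinearMap.intervalIntegral_apply hiD _
  have hiD' : IntervalIntegrable (fun τ => D (y₀, τ) (y - y₀)) volume 0 1 := by
    apply ContinuousOn.intervalIntegrable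
    rw [uIcc_of_le zero_le_one]
    exact (hD.comp (by fun_prop) fun τ hτ => ⟨hy₀, hτ⟩ :
      ContinuousOn (fun τ => D (y₀, τ)) (Icc (0 : ℝ) 1)).clm_apply continuousOn_const
  rw [happ, ← intervalIntegral.integral_sub hi hi₀,
    ← intervalIntegral.integral_sub (hi.sub hi₀) hiD']
  refine (intervalIntegral.norm_integral_le_of_norm_le_const (C := ε * ‖y - y₀‖) ?_).trans ?_
  · intro τ hτ
    rw [uIoc_of_le zero_le_one] at hτ
    exact hmv τ ⟨hτ.1.le, hτ.2⟩
  · simp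

theorem hasFDerivWithinAt_slice {Q : Set E} {g : E × ℝ → F}
    (hg : ContDiffOn ℝ ∞ g (Q ×ˢ Icc (0 : ℝ) 1)) {y : E} (hy : y ∈ Q) {τ : ℝ}
    (hτ : τ ∈ Icc (0 : ℝ) 1) :
    HasFDerivWithinAt (fun y => g (y, τ)) ((fderivWithin ℝ g (Q ×ˢ Icc (0 : ℝ) 1) (y, τ)).comp
      (ContinuousLinearMap.inl ℝ E ℝ)) Q y :=
  HasFDerivWithinAt.comp (g := g) (f := fun y => (y, τ)) (t := Q ×ˢ Icc (0 : ℝ) 1) y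
    (hg.differentiableOn (by simp) (y, τ) ⟨hy, hτ⟩).hasFDerivWithinAt
    (hasFDerivAt_prodMk_left y τ).hasFDerivWithinAt (fun _ hz => ⟨hz, hτ⟩)

/-- Integrals over `[0, 1]` depend smoothly on parameters in a convex set, up to its boundary. -/
theorem contDiffOn_intervalIntegral [CompleteSpace F] {Q : Set E} (hQ : Convex ℝ Q)
    (hQ' : UniqueDiffOn ℝ Q) {g : E × ℝ → F} (hg : ContDiffOn ℝ ∞ g (Q ×ˢ Icc (0 : ℝ) 1)) :
    ContDiffOn ℝ ∞ (fun y => ∫ τ in (0 : ℝ)..1, g (y, τ)) Q := by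
  have hU : UniqueDiffOn ℝ (Q ×ˢ Icc (0 : ℝ) 1) := hQ'.prod (uniqueDiffOn_Icc zero_lt_one)
  rw [contDiffOn_infty]
  intro n
  induction n generalizing F with
  | zero =>
    have hD := hg.fderivWithin (m := ∞) hU (by simp)
    rw [Nat.cast_zero, contDiffOn_zero]
    intro y hy
    refine (hasFDerivWithinAt_intervalIntegral
      (D := fun p => (fderivWithin ℝ g (Q ×ˢ Icc (0 : ℝ) 1) p).comp
        (ContinuousLinearMap.inl ℝ E ℝ)) hQ hg.continuousOn
      (hD.continuousOn.clm_comp continuousOn_const) ?_ hy).continuousWithinAt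
    intro y hy τ hτ
    exact hasFDerivWithinAt_slice hg hy hτ
  | succ n ih =>
    have hD := hg.fderivWithin (m := ∞) hU (by simp)
    have key : ∀ y ∈ Q, HasFDerivWithinAt (fun y => ∫ τ in (0 : ℝ)..1, g (y, τ))
        (∫ τ in (0 : ℝ)..1, (fderivWithin ℝ g (Q ×ˢ Icc (0 : ℝ) 1) (y, τ)).comp
        (ContinuousLinearMap.inl ℝ E ℝ)) Q y := by
      intro y hy
      refine hasFDerivWithinAt_intervalIntegral
        (D := fun p => (fderivWithin ℝ g (Q ×ˢ Icc (0 : ℝ) 1) p).comp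
          (ContinuousLinearMap.inl ℝ E ℝ)) hQ hg.continuousOn
        (hD.continuousOn.clm_comp continuousOn_const) ?_ hy
      intro y hy τ hτ
      exact hasFDerivWithinAt_slice hg hy hτ
    push_cast
    refine contDiffOn_succ_of_fderivWithin (fun y hy => (key y hy).differentiableWithinAt)
      (by simp) ?_
    refine (ih (g := fun p => (fderivWithin ℝ g (Q ×ˢ Icc (0 : ℝ) 1) p).comp
        (ContinuousLinearMap.inl ℝ E ℝ)) (hD.clm_comp contDiffOn_const)).congr ?_
    intro y hy
    exact (key y hy).fderivWithin (hQ' y hy)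

/-- Fundamental theorem of calculus on an interval of any kind, up to its end points. -/
theorem hasDerivWithinAt_integral {s : Set ℝ} (hs : s.OrdConnected) {φ : ℝ → ℝ}
    (hφ : ContinuousOn φ s) {b r : ℝ} (hb : b ∈ s) (hr : r ∈ s) :
    HasDerivWithinAt (fun r => ∫ σ in b..r, φ σ) (φ r) s r := by
  rw [hasDerivWithinAt_iff_isLittleO, Asymptotics.isLittleO_iff]
  intro ε hε
  obtain ⟨δ, hδ, hd⟩ := Metric.continuousWithinAt_iff.1 (hφ r hr) ε hε
  have hii : ∀ p ∈ s, ∀ q ∈ s, IntervalIntegrable φ volume p q := fun p hp q hq =>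
    (hφ.mono (hs.uIcc_subset hp hq)).intervalIntegrable
  filter_upwards [inter_mem_nhdsWithin s (Metric.ball_mem_nhds r hδ)] with q hq
  have e : (∫ σ in b..q, φ σ) - (∫ σ in b..r, φ σ) - (q - r) • φ r
      = ∫ σ in r..q, (φ σ - φ r) := by
    rw [intervalIntegral.integral_sub (hii r hr q hq.1) (by simp),
      intervalIntegral.integral_interval_sub_left (hii b hb q hq.1) (hii b hb r hr)]
    simp
  rw [e]
  refine intervalIntegral.norm_integral_le_of_norm_le_const fun σ hσ => ?_
  have hσ' : σ ∈ uIcc r q := uIoc_subset_uIcc hσ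
  have h1 : dist σ r ≤ dist q r := by
    rw [dist_comm σ, dist_comm q, Real.dist_eq, Real.dist_eq, abs_sub_comm r, abs_sub_comm r]
    exact abs_sub_left_of_mem_uIcc hσ'
  exact (hd (hs.uIcc_subset hr hq.1 hσ') (h1.trans_lt hq.2)).le

end ParametricIntegral

/-! ### The differential algebra of differential functions -/

/-- All coordinates range over intervals with non-empty interior. -/
class IsBox (B : JetCoord → Set ℝ) : Prop where
  ordConnected : ∀ c, (B c).OrdConnected
  interior_nonempty : ∀ c, (interior (B c)).Nonempty

/-- The range of the coordinates in the finite set `s`. -/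
def box (B : JetCoord → Set ℝ) (s : Finset JetCoord) : Set (s → ℝ) := {y | ∀ c : s, y c ∈ B c}

section Box

variable {B : JetCoord → Set ℝ}

theorem box_eq_pi (s : Finset JetCoord) : box B s = Set.univ.pi fun c : s => B c := by
  ext y; simp [box]

theorem restrict_mem_box (s : Finset JetCoord) {z : Jet} (hz : z ∈ jetDomain B) :
    s.restrict z ∈ box B s := fun c => hz c

variable [hB : IsBox B]

theorem uniqueDiffOn_range (c : JetCoord) : UniqueDiffOn ℝ (B c) :=
  uniqueDiffOn_convex (hB.ordConnected c).convex (hB.interior_nonempty c)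

theorem convex_box (s : Finset JetCoord) : Convex ℝ (box B s) := by
  rw [box_eq_pi]
  exact convex_pi fun c _ => (hB.ordConnected c).convex

theorem uniqueDiffOn_box (s : Finset JetCoord) : UniqueDiffOn ℝ (box B s) := by
  rw [box_eq_pi]
  exact UniqueDiffOn.univ_pi fun c => uniqueDiffOn_range c.1

theorem box_subset_closure_interior (s : Finset JetCoord) :
    box B s ⊆ closure (interior (box B s)) := by
  have h : (interior (box B s)).Nonempty := by
    rw [box_eq_pi, interior_pi_set Set.finite_univ]
    exact Set.univ_pi_nonempty_iff.2 fun c => hB.interior_nonempty c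
  rw [(convex_box s).closure_interior_eq_closure_of_nonempty_interior h]
  exact subset_closure

end Box

section Representation

variable {B : JetCoord → Set ℝ}

/-- `f` expresses `F` on the jet domain as a smooth function of the coordinates in `s`. -/
def IsRep (B : JetCoord → Set ℝ) (s : Finset JetCoord) (f : (s → ℝ) → ℝ) (F : Jet → ℝ) : Prop :=
  ContDiffOn ℝ ∞ f (box B s) ∧ ∀ z ∈ jetDomain B, F z = f (s.restrict z)

theorem IsRep.enlarge {s s' : Finset JetCoord} (hs : s ⊆ s') {f : (s → ℝ) → ℝ} {F : Jet → ℝ}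
    (h : IsRep B s f F) : IsRep B s' (fun y => f fun c => y ⟨c, hs c.2⟩) F := by
  refine ⟨h.1.comp (t := box B s) (ContDiff.contDiffOn (contDiff_pi.2 fun c =>
    contDiff_apply ℝ ℝ _)) fun y hy c => hy ⟨c, hs c.2⟩, fun z hz => ?_⟩
  rw [h.2 z hz]
  rfl

theorem pderiv_congr {F F' : Jet → ℝ} (h : Set.EqOn F F' (jetDomain B)) (c : JetCoord) :
    Set.EqOn (pderiv B c F) (pderiv B c F') (jetDomain B) := fun z hz =>
  derivWithin_congr (fun _ hr => h (update_mem hz hr)) (by simpa using h hz)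

theorem IsDiffFun.congr {F F' : Jet → ℝ} (hF : IsDiffFun B F)
    (h : Set.EqOn F' F (jetDomain B)) : IsDiffFun B F' := by
  obtain ⟨s, f, hf, hs⟩ := hF
  exact ⟨s, f, hf, fun z hz => (h hz).trans (hs z hz)⟩

/-- The direction of the coordinate `c` among the coordinates in `s`; it is zero if `c ∉ s`. -/
def dir (s : Finset JetCoord) (c : JetCoord) : s → ℝ := fun d => if (d : JetCoord) = c then 1 else 0

theorem dir_of_notMem {s : Finset JetCoord} {c : JetCoord} (hc : c ∉ s) : dir s c = 0 := by
  funext d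
  have : (d : JetCoord) ≠ c := fun e => hc (e ▸ d.2)
  simp [dir, this]

theorem IsRep.hasDerivWithinAt {s : Finset JetCoord} {f : (s → ℝ) → ℝ} {F : Jet → ℝ}
    (h : IsRep B s f F) {z : Jet} (hz : z ∈ jetDomain B) (c : JetCoord) :
    HasDerivWithinAt (fun r : ℝ => F (Function.update z c r))
      (fderivWithin ℝ f (box B s) (s.restrict z) (dir s c)) (B c) (z c) := by
  have h1 : HasDerivWithinAt (fun r : ℝ => s.restrict (Function.update z c r)) (dir s c)
      (B c) (z c) := by
    refine hasDerivWithinAt_pi.2 fun d => ?_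
    by_cases hd : (d : JetCoord) = c
    · simp only [dir, hd, if_true]
      simpa only [Finset.restrict, hd, Function.update_self] using
        (hasDerivAt_id' (z c)).hasDerivWithinAt
    · simp only [dir, hd, if_false]
      simpa [Finset.restrict, Function.update, hd] using hasDerivWithinAt_const (z c) (B c) (z d)
  have h2 : HasFDerivWithinAt f (fderivWithin ℝ f (box B s) (s.restrict z)) (box B s)
      (s.restrict (Function.update z c (z c))) := by
    rw [Function.update_eq_self]
    exact (h.1.differentiableOn (by simp) _ (restrict_mem_box s hz)).hasFDerivWithinAt
  have h3 := h2.comp_hasDerivWithinAt (z c) h1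
    (fun r hr => restrict_mem_box s (update_mem hz hr))
  exact h3.congr (fun r hr => h.2 _ (update_mem hz hr)) (h.2 _ (update_mem hz (hz c)))

variable [IsBox B]

theorem IsRep.pderiv_eq {s : Finset JetCoord} {f : (s → ℝ) → ℝ} {F : Jet → ℝ}
    (h : IsRep B s f F) {z : Jet} (hz : z ∈ jetDomain B) (c : JetCoord) :
    pderiv B c F z = fderivWithin ℝ f (box B s) (s.restrict z) (dir s c) :=
  (h.hasDerivWithinAt hz c).derivWithin (uniqueDiffOn_range c _ (hz c))

theorem IsRep.pderiv {s : Finset JetCoord} {f : (s → ℝ) → ℝ} {F : Jet → ℝ}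
    (h : IsRep B s f F) (c : JetCoord) :
    IsRep B s (fun y => fderivWithin ℝ f (box B s) y (dir s c)) (pderiv B c F) :=
  ⟨(h.1.fderivWithin (uniqueDiffOn_box s) (by simp)).clm_apply contDiffOn_const,
    fun _ hz => h.pderiv_eq hz c⟩

theorem IsDiffFun.pderiv {F : Jet → ℝ} (h : IsDiffFun B F) (c : JetCoord) :
    IsDiffFun B (pderiv B c F) := by
  obtain ⟨s, f, hf⟩ := h
  exact ⟨s, _, IsRep.pderiv hf c⟩

theorem pderiv_comm {F : Jet → ℝ} (h : IsDiffFun B F) (c d : JetCoord) {z : Jet}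
    (hz : z ∈ jetDomain B) :
    LocalCL.pderiv B c (LocalCL.pderiv B d F) z = LocalCL.pderiv B d (LocalCL.pderiv B c F) z := by
  obtain ⟨s, f, hf⟩ := h
  have hbox := restrict_mem_box s hz
  have hsymm : IsSymmSndFDerivWithinAt ℝ f (box B s) (s.restrict z) :=
    (hf.1 _ hbox).isSymmSndFDerivWithinAt
      (by simpa using WithTop.coe_le_coe.2 (le_top : (2 : ℕ∞) ≤ ⊤)) (uniqueDiffOn_box s)
      (box_subset_closure_interior s hbox) hbox
  have key : ∀ c d, LocalCL.pderiv B c (LocalCL.pderiv B d F) z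
      = fderivWithin ℝ (fderivWithin ℝ f (box B s)) (box B s) (s.restrict z) (dir s c)
        (dir s d) := by
    intro c d
    have hd : DifferentiableWithinAt ℝ (fderivWithin ℝ f (box B s)) (box B s) (s.restrict z) :=
      (hf.1.fderivWithin (m := ∞) (uniqueDiffOn_box s) (by simp)).differentiableOn
        (by simp) _ hbox
    rw [(IsRep.pderiv hf d).pderiv_eq hz c,
      fderivWithin_clm_apply (uniqueDiffOn_box s _ hbox) hd (differentiableWithinAt_const _)]
    simp
  rw [key c d, key d c, hsymm.eq]

end Representation

/-- The algebra of differential functions, as functions on the jet domain: restricting to the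
domain makes two differential functions equal once they agree where this is meaningful. -/
def DiffAlg (B : JetCoord → Set ℝ) : Subalgebra ℝ (jetDomain B → ℝ) where
  carrier := {F | ∃ (s : Finset JetCoord) (f : (s → ℝ) → ℝ), ContDiffOn ℝ ∞ f (box B s) ∧
    ∀ z : jetDomain B, F z = f (s.restrict z.1)}
  mul_mem' := by
    classical
    rintro F F' ⟨s, f, hf, h⟩ ⟨s', f', hf', h'⟩
    refine ⟨s ∪ s', fun y => f (fun c => y ⟨c, Finset.mem_union_left _ c.2⟩)
      * f' (fun c => y ⟨c, Finset.mem_union_right _ c.2⟩), ?_, fun z => ?_⟩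
    · refine ContDiffOn.mul (hf.comp (t := box B s)
        (ContDiff.contDiffOn (contDiff_pi.2 fun c => contDiff_apply ℝ ℝ _)) ?_)
        (hf'.comp (t := box B s')
        (ContDiff.contDiffOn (contDiff_pi.2 fun c => contDiff_apply ℝ ℝ _)) ?_)
      · exact fun y hy c => hy ⟨c, Finset.mem_union_left _ c.2⟩
      · exact fun y hy c => hy ⟨c, Finset.mem_union_right _ c.2⟩
    · rw [Pi.mul_apply, h, h']
      rfl
  add_mem' := by
    classical
    rintro F F' ⟨s, f, hf, h⟩ ⟨s', f', hf', h'⟩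
    refine ⟨s ∪ s', fun y => f (fun c => y ⟨c, Finset.mem_union_left _ c.2⟩)
      + f' (fun c => y ⟨c, Finset.mem_union_right _ c.2⟩), ?_, fun z => ?_⟩
    · refine ContDiffOn.add (hf.comp (t := box B s)
        (ContDiff.contDiffOn (contDiff_pi.2 fun c => contDiff_apply ℝ ℝ _)) ?_)
        (hf'.comp (t := box B s')
        (ContDiff.contDiffOn (contDiff_pi.2 fun c => contDiff_apply ℝ ℝ _)) ?_)
      · exact fun y hy c => hy ⟨c, Finset.mem_union_left _ c.2⟩
      · exact fun y hy c => hy ⟨c, Finset.mem_union_right _ c.2⟩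
    · rw [Pi.add_apply, h, h']
      rfl
  algebraMap_mem' a := ⟨∅, fun _ => a, contDiffOn_const, fun _ => rfl⟩

section Algebra

variable {B : JetCoord → Set ℝ}

/-- The restriction of a differential function to the jet domain. -/
def res (F : Jet → ℝ) (h : IsDiffFun B F) : DiffAlg B :=
  ⟨fun z => F z, by
    obtain ⟨s, f, hf, hs⟩ := h
    exact ⟨s, f, hf, fun z => hs z z.2⟩⟩

open Classical in
/-- Extension by zero of a differential function from the jet domain. -/
def ext (F : DiffAlg B) : Jet → ℝ := fun z => if h : z ∈ jetDomain B then F.1 ⟨z, h⟩ else 0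

theorem ext_apply (F : DiffAlg B) {z : Jet} (hz : z ∈ jetDomain B) : ext F z = F.1 ⟨z, hz⟩ :=
  dif_pos hz

theorem isDiffFun_ext (F : DiffAlg B) : IsDiffFun B (ext F) := by
  obtain ⟨s, f, hf, hs⟩ := F.2
  exact ⟨s, f, hf, fun z hz => (ext_apply F hz).trans (hs ⟨z, hz⟩)⟩

theorem DiffAlg.ext_pt {F F' : DiffAlg B} (h : ∀ z, F.1 z = F'.1 z) : F = F' :=
  Subtype.ext (funext h)

/-- The jet obtained from `z` by giving the coordinate `c` the value `r`. -/
def upd (z : jetDomain B) (c : JetCoord) {r : ℝ} (hr : r ∈ B c) : jetDomain B :=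
  ⟨Function.update z.1 c r, update_mem z.2 hr⟩

theorem ext_update (F : DiffAlg B) (z : jetDomain B) (c : JetCoord) {r : ℝ} (hr : r ∈ B c) :
    ext F (Function.update z.1 c r) = F.1 (upd z c hr) := ext_apply _ _

/-- A function of the single coordinate `c`. -/
def fn (c : JetCoord) (g : ℝ → ℝ) (hg : ContDiffOn ℝ ∞ g (B c)) : DiffAlg B :=
  ⟨fun z => g (z.1 c), {c}, fun y => g (y ⟨c, Finset.mem_singleton_self c⟩),
    hg.comp (ContDiff.contDiffOn (contDiff_apply ℝ ℝ _)) fun _ hy => hy ⟨c, Finset.mem_singleton_self c⟩, fun _ => rfl⟩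

/-- The coordinate `c` as a differential function. -/
def X (c : JetCoord) : DiffAlg B := fn c (fun y => y) contDiffOn_id

theorem X_apply (c : JetCoord) (z : jetDomain B) : (X c : DiffAlg B).1 z = z.1 c := rfl

variable [IsBox B]

/-- `∂F/∂c` as a function on the jet domain. -/
def pdFun (c : JetCoord) (F : DiffAlg B) : DiffAlg B :=
  res (pderiv B c (ext F)) ((isDiffFun_ext F).pderiv c)

theorem hasDerivWithinAt_pdFun (F : DiffAlg B) (z : jetDomain B) (c : JetCoord) :
    HasDerivWithinAt (fun r : ℝ => ext F (Function.update z.1 c r)) ((pdFun c F).1 z) (B c)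
      (z.1 c) :=
  ((isDiffFun_ext F).differentiableWithinAt z.2 c).hasDerivWithinAt

theorem pdFun_eq_of_hasDerivWithinAt {F G : DiffAlg B} {c : JetCoord}
    (h : ∀ z : jetDomain B, HasDerivWithinAt (fun r : ℝ => ext F (Function.update z.1 c r))
      (G.1 z) (B c) (z.1 c)) : pdFun c F = G :=
  DiffAlg.ext_pt fun z => (h z).derivWithin (uniqueDiffOn_range c _ (z.2 c))

/-- The partial derivative with respect to the jet coordinate `c`. -/
def pd (c : JetCoord) : Derivation ℝ (DiffAlg B) (DiffAlg B) :=
  Derivation.mk'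
    { toFun := pdFun c
      map_add' := fun F G => pdFun_eq_of_hasDerivWithinAt fun z =>
        ((hasDerivWithinAt_pdFun F z c).add (hasDerivWithinAt_pdFun G z c)).congr_of_mem
          (fun r hr => by simp [ext_update _ z c hr]) (z.2 c)
      map_smul' := fun a F => pdFun_eq_of_hasDerivWithinAt fun z =>
        ((hasDerivWithinAt_pdFun F z c).const_mul a).congr_of_mem
          (fun r hr => by simp [ext_update _ z c hr]) (z.2 c) }
    (fun F G => pdFun_eq_of_hasDerivWithinAt fun z => by
      have := ((hasDerivWithinAt_pdFun F z c).mul (hasDerivWithinAt_pdFun G z c)).congr_of_mem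
          (f₁ := fun r : ℝ => ext (F * G) (Function.update z.1 c r))
          (fun r hr => by simp [ext_update _ z c hr]) (z.2 c)
      refine this.congr_deriv ?_
      rw [Function.update_eq_self, ext_apply F z.2, ext_apply G z.2]
      simp
      ring)

theorem hasDerivWithinAt_pd (F : DiffAlg B) (z : jetDomain B) (c : JetCoord) :
    HasDerivWithinAt (fun r : ℝ => ext F (Function.update z.1 c r)) ((pd c F).1 z) (B c)
      (z.1 c) := hasDerivWithinAt_pdFun F z c

theorem pd_eq_of_hasDerivWithinAt {F G : DiffAlg B} {c : JetCoord}
    (h : ∀ z : jetDomain B, HasDerivWithinAt (fun r : ℝ => ext F (Function.update z.1 c r))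
      (G.1 z) (B c) (z.1 c)) : pd c F = G := pdFun_eq_of_hasDerivWithinAt h

theorem pd_apply (F : DiffAlg B) (z : jetDomain B) (c : JetCoord) :
    (pd c F).1 z = pderiv B c (ext F) z.1 := rfl

theorem pd_comm (c d : JetCoord) (F : DiffAlg B) : pd c (pd d F) = pd d (pd c F) := by
  refine DiffAlg.ext_pt fun z => ?_
  have key : ∀ c d, (pd c (pd d F)).1 z = pderiv B c (pderiv B d (ext F)) z.1 := fun c d =>
    pderiv_congr (fun w hw => ext_apply _ hw) c z.2
  rw [key, key, pderiv_comm (isDiffFun_ext F) c d z.2]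

theorem exists_support (F : DiffAlg B) : ∃ s : Finset JetCoord, ∀ c ∉ s, pd c F = 0 := by
  obtain ⟨s, f, hf⟩ := isDiffFun_ext F
  refine ⟨s, fun c hc => DiffAlg.ext_pt fun z => ?_⟩
  rw [pd_apply, IsRep.pderiv_eq hf z.2, dir_of_notMem hc]
  simp

theorem pd_fn (c : JetCoord) (g g' : ℝ → ℝ) (hg : ContDiffOn ℝ ∞ g (B c))
    (hg' : ContDiffOn ℝ ∞ g' (B c)) (h : ∀ y ∈ B c, HasDerivWithinAt g (g' y) (B c) y) :
    pd c (fn c g hg) = fn c g' hg' :=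
  pd_eq_of_hasDerivWithinAt fun z => (h (z.1 c) (z.2 c)).congr_of_mem
    (fun r hr => by rw [ext_update _ z c hr]; simp [fn, upd]) (z.2 c)

theorem pd_fn_of_ne {c d : JetCoord} (hcd : d ≠ c) (g : ℝ → ℝ) (hg : ContDiffOn ℝ ∞ g (B c)) :
    pd d (fn c g hg) = 0 :=
  pd_eq_of_hasDerivWithinAt fun z => (hasDerivWithinAt_const (z.1 d) (B d) (g (z.1 c))).congr_of_mem
    (fun r hr => by rw [ext_update _ z d hr]; simp [fn, upd, Function.update_of_ne hcd.symm])
    (z.2 d)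

theorem pd_X_self (c : JetCoord) : pd c (X c : DiffAlg B) = 1 :=
  (pd_fn c _ (fun _ => 1) _ contDiffOn_const fun y _ => hasDerivWithinAt_id y _).trans
    (DiffAlg.ext_pt fun _ => rfl)

theorem pd_X_of_ne {c d : JetCoord} (h : d ≠ c) : pd d (X c : DiffAlg B) = 0 := pd_fn_of_ne h _ _

/-- A differential function takes the same value at two jets if it has vanishing derivative with
respect to every coordinate in which they differ. -/
theorem eq_of_pd_eq_zero (F : DiffAlg B) (z z' : jetDomain B)
    (h : ∀ c, z.1 c ≠ z'.1 c → pd c F = 0) : F.1 z = F.1 z' := by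
  have step : ∀ (s : Finset JetCoord) (z : jetDomain B),
      (∀ c, z.1 c ≠ z'.1 c → pd c F = 0) → (∀ c ∉ s, z.1 c = z'.1 c) → F.1 z = F.1 z' := by
    intro s
    induction s using Finset.induction_on with
    | empty =>
      intro z _ hz
      rw [Subtype.ext (funext fun c => hz c (by simp))]
    | insert c s _ ih =>
      intro z h hz
      have h1 : F.1 z = F.1 (upd z c (z'.2 c)) := by
        by_cases hc : z.1 c = z'.1 c
        · have e : upd z c (z'.2 c) = z := Subtype.ext
            (show Function.update z.1 c (z'.1 c) = z.1 by rw [← hc, Function.update_eq_self])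
          rw [e]
        · have h0 : ∀ r ∈ B c, derivWithin (fun r => ext F (Function.update z.1 c r)) (B c) r
              = 0 := by
            intro r hr
            have := hasDerivWithinAt_pd F (upd z c hr) c
            simp only [upd, Function.update_idem, Function.update_self, h c hc] at this
            exact this.derivWithin (uniqueDiffOn_range c _ hr)
          have hd : DifferentiableOn ℝ (fun r => ext F (Function.update z.1 c r)) (B c) := by
            intro r hr
            have := (hasDerivWithinAt_pd F (upd z c hr) c).differentiableWithinAt
            simpa only [upd, Function.update_idem, Function.update_self] using this
          have := Convex.is_const_of_fderivWithin_eq_zero (IsBox.ordConnected (B := B) c).convex hd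
            (fun r hr => by
              ext
              rw [fderivWithin_derivWithin, h0 r hr]
              rfl) (z.2 c) (z'.2 c)
          simp only [Function.update_eq_self] at this
          rw [ext_apply F z.2, ext_update F z c (z'.2 c)] at this
          exact this
      rw [h1]
      refine ih _ (fun d hd => ?_) fun d hd => ?_
      · by_cases hdc : d = c
        · subst hdc; simp [upd] at hd
        · exact h d (by simpa [upd, hdc] using hd)
      · by_cases hdc : d = c
        · subst hdc; simp [upd]
        · simpa [upd, hdc] using hz d (by simp [hdc, hd])
  obtain ⟨s, f, _, hs⟩ := F.2
  -- Coordinates outside `s` are irrelevant, so that only finitely many have to be changed.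
  have hw : (fun c => if c ∈ s then z.1 c else z'.1 c) ∈ jetDomain B := fun c => by
    by_cases hc : c ∈ s <;> simp [hc, z.2 c, z'.2 c]
  have e : F.1 z = F.1 ⟨_, hw⟩ := by
    rw [hs, hs]
    congr 1
    funext c
    simp [Finset.restrict]
  rw [e]
  refine step s _ (fun c hc => ?_) fun c hc => by simp [hc]
  by_cases hcs : c ∈ s
  · exact h c (by simpa [hcs] using hc)
  · simp [hcs] at hc

end Algebra

/-! ### Antiderivatives, substitutions and vector fields -/

section Calculus

variable {B : JetCoord → Set ℝ}

theorem restrict_update {s : Finset JetCoord} {c : JetCoord} (hc : c ∈ s) (z : Jet) (r : ℝ) :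
    s.restrict (Function.update z c r) = Function.update (s.restrict z) ⟨c, hc⟩ r := by
  funext d
  by_cases hd : (d : JetCoord) = c
  · obtain rfl : d = ⟨c, hc⟩ := Subtype.ext hd
    simp [Finset.restrict]
  · have : d ≠ ⟨c, hc⟩ := fun e => hd (congrArg Subtype.val e)
    simp [Finset.restrict, hd, this]

/-- A substitution of differential functions for the jet coordinates. -/
structure Subst (B : JetCoord → Set ℝ) where
  /-- the function substituted for each coordinate -/
  comp : JetCoord → DiffAlg B
  mem : ∀ c z, (comp c).1 z ∈ B c

/-- The map of the jet domain to itself whose coordinates are the components of `ρ`. -/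
def Subst.map (ρ : Subst B) (z : jetDomain B) : jetDomain B :=
  ⟨fun c => (ρ.comp c).1 z, fun c => ρ.mem c z⟩

theorem Subst.map_apply (ρ : Subst B) (z : jetDomain B) (c : JetCoord) :
    (ρ.map z).1 c = (ρ.comp c).1 z := rfl

theorem sum_eq_sum_of_support {w : JetCoord → DiffAlg B} {s s' : Finset JetCoord}
    (hs : ∀ c ∉ s, w c = 0) (hs' : ∀ c ∉ s', w c = 0) : ∑ c ∈ s, w c = ∑ c ∈ s', w c := by
  rw [← finsum_eq_sum_of_support_subset w (s := s), ← finsum_eq_sum_of_support_subset w (s := s')]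
  · exact fun c hc => by_contra fun h => hc (hs' c h)
  · exact fun c hc => by_contra fun h => hc (hs c h)

variable [hB : IsBox B]

theorem range_nonempty (c : JetCoord) : (B c).Nonempty :=
  (hB.interior_nonempty c).mono interior_subset

theorem contDiffOn_line_integral {s : Finset JetCoord} (c : s) {f : (s → ℝ) → ℝ}
    (hf : ContDiffOn ℝ ∞ f (box B s)) {b : ℝ} (hb : b ∈ B c) :
    ContDiffOn ℝ ∞ (fun y : s → ℝ => ∫ σ in b..y c, f (Function.update y c σ)) (box B s) := by
  classical
  -- The substitution `σ = b + (y c - b) τ` turns this into an integral over a fixed interval.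
  have h : ContDiffOn ℝ ∞ (fun p : (s → ℝ) × ℝ =>
      (p.1 c - b) * f (Function.update p.1 c (b + (p.1 c - b) * p.2)))
      (box B s ×ˢ Set.Icc (0 : ℝ) 1) := by
    refine ContDiffOn.mul (ContDiff.contDiffOn (by fun_prop)) (hf.comp (t := box B s)
      (ContDiff.contDiffOn (contDiff_pi.2 fun d => ?_)) ?_)
    · by_cases hd : d = c
      · subst hd
        simp only [Function.update_self]
        fun_prop
      · simp only [Function.update_of_ne hd]
        fun_prop
    · rintro ⟨y, τ⟩ ⟨hy, hτ⟩ d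
      by_cases hd : d = c
      · subst hd
        simp only [Function.update_self]
        have := (hB.ordConnected d).convex.add_smul_sub_mem hb (hy d) hτ
        simpa [mul_comm] using this
      · simpa only [Function.update_of_ne hd] using hy d
  refine (contDiffOn_intervalIntegral (convex_box s) (uniqueDiffOn_box s) h).congr fun y _ => ?_
  have := intervalIntegral.smul_integral_comp_add_mul (a := 0) (b := 1)
    (fun σ => f (Function.update y c σ)) (y c - b) b
  simp only [smul_eq_mul, mul_zero, add_zero, mul_one, add_sub_cancel] at this
  rw [← this]
  exact (intervalIntegral.integral_const_mul _ _).symm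

/-- A differential function has an antiderivative with respect to each coordinate. -/
theorem exists_antideriv (c : JetCoord) (F : DiffAlg B) :
    ∃ H : DiffAlg B, pd c H = F ∧ ∀ d, d ≠ c → pd d F = 0 → pd d H = 0 := by
  obtain ⟨s₀, f₀, hf₀⟩ := isDiffFun_ext F
  obtain ⟨s, f, hf, hcs⟩ : ∃ s f, IsRep B s f (ext F) ∧ c ∈ s :=
    ⟨insert c s₀, _, IsRep.enlarge (Finset.subset_insert c s₀) hf₀, Finset.mem_insert_self c s₀⟩
  obtain ⟨b, hb⟩ := range_nonempty (B := B) c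
  have hval : ∀ (z : jetDomain B) {r : ℝ} (hr : r ∈ B c),
      F.1 (upd z c hr) = f (Function.update (s.restrict z.1) ⟨c, hcs⟩ r) := fun z r hr => by
    rw [← restrict_update hcs, ← hf.2 _ (update_mem z.2 hr), ext_update F z c hr]
  let H : DiffAlg B := ⟨fun z => ∫ σ in b..z.1 c, f (Function.update (s.restrict z.1) ⟨c, hcs⟩ σ),
    s, _, contDiffOn_line_integral ⟨c, hcs⟩ hf.1 hb, fun z => rfl⟩
  have hH : ∀ z : jetDomain B, H.1 z
    = ∫ σ in b..z.1 c, f (Function.update (s.restrict z.1) ⟨c, hcs⟩ σ) := fun z => rfl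
  refine ⟨H, pd_eq_of_hasDerivWithinAt fun z => ?_, fun d hdc hd =>
    pd_eq_of_hasDerivWithinAt fun z => ?_⟩
  · have hcont : ContinuousOn (fun σ => f (Function.update (s.restrict z.1) ⟨c, hcs⟩ σ)) (B c) := by
      refine hf.1.continuousOn.comp (Continuous.continuousOn (by fun_prop)) fun r hr => ?_
      rw [← restrict_update hcs]
      exact restrict_mem_box s (update_mem z.2 hr)
    refine ((hasDerivWithinAt_integral (hB.ordConnected c) hcont hb (z.2 c)).congr_of_mem
      (fun r hr => ?_) (z.2 c)).congr_deriv ?_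
    · rw [ext_update H z c hr, hH]
      simp only [upd, restrict_update hcs, Function.update_idem, Function.update_self]
    · have e : upd z c (z.2 c) = z := Subtype.ext (Function.update_eq_self _ _)
      rw [← hval z (z.2 c), e]
  · refine (hasDerivWithinAt_const (z.1 d) (B d) (H.1 z)).congr_of_mem (fun r hr => ?_) (z.2 d)
    rw [ext_update H z d hr, hH, hH]
    have hz : (upd z d hr).1 c = z.1 c := Function.update_of_ne hdc.symm _ _
    rw [hz]
    refine intervalIntegral.integral_congr fun σ hσ => ?_
    have hσ' : σ ∈ B c := (hB.ordConnected c).uIcc_subset hb (z.2 c) hσ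
    change f _ = f _
    rw [← hval _ hσ', ← hval _ hσ']
    refine eq_of_pd_eq_zero F _ _ fun e he => ?_
    by_cases hed : e = d
    · rw [hed, hd]
    · refine absurd ?_ he
      by_cases hec : e = c
      · subst hec; simp [upd]
      · simp [upd, hec, hed]

theorem exists_jet_of_mem_box {s : Finset JetCoord} {y : s → ℝ} (hy : y ∈ box B s) :
    ∃ z : jetDomain B, s.restrict z.1 = y := by
  classical
  choose b hb using range_nonempty (B := B)
  refine ⟨⟨fun c => if h : c ∈ s then y ⟨c, h⟩ else b c, fun c => ?_⟩, ?_⟩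
  · by_cases h : c ∈ s
    · simpa [h] using hy ⟨c, h⟩
    · simpa [h] using hb c
  · funext c
    simp [Finset.restrict]

theorem Subst.comp_mem (ρ : Subst B) (F : DiffAlg B) :
    (fun z => F.1 (ρ.map z)) ∈ DiffAlg B := by
  obtain ⟨s, f, hf, hs⟩ := F.2
  choose S g hg hS using fun d => (ρ.comp d).2
  have hsub : ∀ d : s, S d ⊆ s.biUnion S := fun d => Finset.subset_biUnion_of_mem S d.2
  refine ⟨s.biUnion S, fun y => f fun d => g d fun c => y ⟨c, hsub d c.2⟩, ?_, fun z => ?_⟩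
  · refine hf.comp (t := box B s) (contDiffOn_pi.2 fun d => (hg d).comp (t := box B (S d))
      (ContDiff.contDiffOn (contDiff_pi.2 fun c => contDiff_apply ℝ ℝ _))
      fun y hy c => hy ⟨c, hsub d c.2⟩) fun y hy d => ?_
    obtain ⟨z, rfl⟩ := exists_jet_of_mem_box hy
    have h1 := ρ.mem d z
    rwa [hS] at h1
  · refine (hs (ρ.map z)).trans (congrArg f ?_)
    funext d
    exact hS d z

/-- Substitution in differential functions. -/
def Subst.pull (ρ : Subst B) : DiffAlg B →ₐ[ℝ] DiffAlg B where
  toFun F := ⟨fun z => F.1 (ρ.map z), ρ.comp_mem F⟩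
  map_one' := rfl
  map_mul' _ _ := rfl
  map_zero' := rfl
  map_add' _ _ := rfl
  commutes' _ := rfl

theorem Subst.pull_apply (ρ : Subst B) (F : DiffAlg B) (z : jetDomain B) :
    (ρ.pull F).1 z = F.1 (ρ.map z) := rfl

theorem Subst.pull_X (ρ : Subst B) (c : JetCoord) : ρ.pull (X c) = ρ.comp c := rfl

theorem Subst.pd_pull (ρ : Subst B) (c : JetCoord) {F : DiffAlg B} {s : Finset JetCoord}
    (hs : ∀ d ∉ s, pd d F = 0) :
    pd c (ρ.pull F) = ∑ d ∈ s, ρ.pull (pd d F) * pd c (ρ.comp d) := by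
  obtain ⟨s₀, f, hf⟩ := isDiffFun_ext F
  replace hf : IsRep B s₀ f (ext F) := hf
  have hpd : ∀ d (z : jetDomain B),
      (pd d F).1 z = fderivWithin ℝ f (box B s₀) (s₀.restrict z.1) (dir s₀ d) :=
    fun d z => hf.pderiv_eq z.2 d
  have hs₀ : ∀ d ∉ s₀, pd d F = 0 := fun d hd => DiffAlg.ext_pt fun z => by
    rw [hpd, dir_of_notMem hd]
    simp
  rw [sum_eq_sum_of_support (s' := s₀) (fun d hd => by rw [hs d hd]; simp)
    (fun d hd => by rw [hs₀ d hd]; simp)]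
  refine pd_eq_of_hasDerivWithinAt fun z => ?_
  have h1 : HasDerivWithinAt (fun (r : ℝ) (d : s₀) => ext (ρ.comp d) (Function.update z.1 c r))
      (fun d => (pd c (ρ.comp d)).1 z) (B c) (z.1 c) :=
    hasDerivWithinAt_pi.2 fun d => hasDerivWithinAt_pd _ _ _
  have e : (fun d : s₀ => ext (ρ.comp d) (Function.update z.1 c (z.1 c)))
      = s₀.restrict (ρ.map z).1 := by
    funext d
    rw [Function.update_eq_self, ext_apply _ z.2]
    rfl
  have h2 : HasFDerivWithinAt f (fderivWithin ℝ f (box B s₀) (s₀.restrict (ρ.map z).1)) (box B s₀)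
      (fun d : s₀ => ext (ρ.comp d) (Function.update z.1 c (z.1 c))) := by
    rw [e]
    exact (hf.1.differentiableOn (by simp) _ (restrict_mem_box s₀ (ρ.map z).2)).hasFDerivWithinAt
  have hmaps : Set.MapsTo (fun (r : ℝ) (d : s₀) => ext (ρ.comp d) (Function.update z.1 c r))
      (B c) (box B s₀) := fun r hr d => by
    simp only [ext_update _ z c hr]
    exact ρ.mem d _
  have h3 := h2.comp_hasDerivWithinAt (z.1 c) h1 hmaps
  refine (h3.congr_of_mem (fun r hr => ?_) (z.2 c)).congr_deriv ?_
  · rw [ext_update _ z c hr, Subst.pull_apply, ← ext_apply F (ρ.map _).2, hf.2 _ (ρ.map _).2]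
    simp only [Function.comp, ext_update _ z c hr]
    rfl
  · have e1 : ∀ (L : (s₀ → ℝ) →L[ℝ] ℝ) (v : s₀ → ℝ), L v = ∑ d : s₀, L (dir s₀ d) * v d := by
      intro L v
      rw [← ContinuousLinearMap.coe_coe, LinearMap.pi_apply_eq_sum_univ L.toLinearMap v]
      refine Finset.sum_congr rfl fun d _ => ?_
      rw [smul_eq_mul, mul_comm]
      congr 2
      funext d'
      exact if_congr (by rw [Subtype.ext_iff, eq_comm]) rfl rfl
    rw [e1, ← Finset.sum_coe_sort s₀]
    simp only [AddSubmonoidClass.coe_finsetSum, Finset.sum_apply, MulMemClass.coe_mul,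
      Pi.mul_apply, Subst.pull_apply, hpd]

/-- The derivation `∑ w_c ∂/∂c`; it is a finite sum on every differential function. -/
def V (w : JetCoord → DiffAlg B) : Derivation ℝ (DiffAlg B) (DiffAlg B) :=
  have hfin : ∀ F : DiffAlg B, (Function.support fun c => w c * pd c F).Finite := fun F => by
    obtain ⟨s, hs⟩ := exists_support F
    exact s.finite_toSet.subset fun c hc => by_contra fun h => hc (by
      change w c * pd c F = 0
      rw [hs c h, mul_zero])
  Derivation.mk'
    { toFun := fun F => ∑ᶠ c, w c * pd c F
      map_add' := fun F G => by
        rw [← finsum_add_distrib (hfin F) (hfin G)]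
        simp only [map_add, mul_add]
      map_smul' := fun a F => by
        rw [RingHom.id_apply, smul_finsum' a (hfin F)]
        exact finsum_congr fun c => by rw [Derivation.map_smul, mul_smul_comm] }
    (fun F G => by
      have h1 : (Function.support fun c => F * (w c * pd c G)).Finite :=
        (hfin G).subset fun c hc h => hc (by simp only at h; simp only [h, mul_zero])
      have h2 : (Function.support fun c => G * (w c * pd c F)).Finite :=
        (hfin F).subset fun c hc h => hc (by simp only at h; simp only [h, mul_zero])
      simp only [LinearMap.coe_mk, AddHom.coe_mk, smul_eq_mul]
      rw [mul_finsum' _ _ (hfin G), mul_finsum' _ _ (hfin F), ← finsum_add_distrib h1 h2]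
      refine finsum_congr fun c => ?_
      rw [Derivation.leibniz, smul_eq_mul, smul_eq_mul]
      ring)

theorem V_eq_sum (w : JetCoord → DiffAlg B) {F : DiffAlg B} {s : Finset JetCoord}
    (hs : ∀ c ∉ s, pd c F = 0) : V w F = ∑ c ∈ s, w c * pd c F :=
  finsum_eq_sum_of_support_subset _ fun c hc => by_contra fun h => hc (by
    change w c * pd c F = 0
    rw [hs c h, mul_zero])

theorem V_X (w : JetCoord → DiffAlg B) (c : JetCoord) : V w (X c) = w c := by
  rw [V_eq_sum (s := {c}) w fun d hd => pd_X_of_ne (by simpa using hd)]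
  simp [pd_X_self]

theorem V_zero (F : DiffAlg B) : V (fun _ => 0) F = 0 := by
  obtain ⟨s, hs⟩ := exists_support F
  rw [V_eq_sum _ hs]
  simp

theorem V_single [DecidableEq JetCoord] (c : JetCoord) (F : DiffAlg B) :
    V (fun d => if d = c then 1 else 0) F = pd c F := by
  obtain ⟨s, hs⟩ := exists_support F
  rw [V_eq_sum (s := insert c s) _ fun d hd => hs d fun h => hd (Finset.mem_insert_of_mem h)]
  simp

theorem V_V (w v : JetCoord → DiffAlg B) {F : DiffAlg B} {s : Finset JetCoord}
    (hs : ∀ c ∉ s, pd c F = 0) : V w (V v F)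
      = ∑ c ∈ s, V w (v c) * pd c F + ∑ c ∈ s, ∑ d ∈ s, v c * w d * pd c (pd d F) := by
  rw [V_eq_sum v hs, map_sum, ← Finset.sum_add_distrib]
  refine Finset.sum_congr rfl fun c _ => ?_
  rw [Derivation.leibniz, V_eq_sum (s := s) w fun d hd => by rw [pd_comm, hs d hd, map_zero]]
  simp only [smul_eq_mul, Finset.mul_sum]
  rw [add_comm, mul_comm]
  congr 1
  refine Finset.sum_congr rfl fun d _ => ?_
  rw [pd_comm]
  ring

/-- The commutator of two vector fields on the jet domain. -/
theorem V_comm (w v : JetCoord → DiffAlg B) (F : DiffAlg B) :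
    V w (V v F) = V v (V w F) + V (fun c => V w (v c) - V v (w c)) F := by
  obtain ⟨s, hs⟩ := exists_support F
  rw [V_V w v hs, V_V v w hs, V_eq_sum _ hs, Finset.sum_comm (s := s) (t := s)]
  simp only [sub_mul, Finset.sum_sub_distrib]
  have : ∑ d ∈ s, ∑ c ∈ s, v c * w d * pd c (pd d F)
      = ∑ c ∈ s, ∑ d ∈ s, w c * v d * pd c (pd d F) :=
    Finset.sum_congr rfl fun d _ => Finset.sum_congr rfl fun c _ => by rw [pd_comm]; ring
  rw [this]
  ring

theorem Subst.V_pull (ρ : Subst B) (w : JetCoord → DiffAlg B) {F : DiffAlg B}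
    {s : Finset JetCoord} (hs : ∀ d ∉ s, pd d F = 0) :
    V w (ρ.pull F) = ∑ d ∈ s, ρ.pull (pd d F) * V w (ρ.comp d) := by
  choose S hS using fun d => exists_support (ρ.comp d)
  obtain ⟨s₁, hs₁⟩ := exists_support (ρ.pull F)
  rw [V_eq_sum (s := s₁ ∪ s.biUnion S) w fun c hc =>
    hs₁ c fun h => hc (Finset.mem_union_left _ h)]
  have : ∀ d ∈ s, V w (ρ.comp d) = ∑ c ∈ s₁ ∪ s.biUnion S, w c * pd c (ρ.comp d) := fun d hd =>
    V_eq_sum w fun c hc => hS d c fun h =>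
      hc (Finset.mem_union_right _ (Finset.mem_biUnion.2 ⟨d, hd, h⟩))
  have e : ∑ d ∈ s, ρ.pull (pd d F) * V w (ρ.comp d)
      = ∑ d ∈ s, ∑ c ∈ s₁ ∪ s.biUnion S, ρ.pull (pd d F) * (w c * pd c (ρ.comp d)) :=
    Finset.sum_congr rfl fun d hd => by rw [this d hd, Finset.mul_sum]
  rw [e, Finset.sum_comm]
  refine Finset.sum_congr rfl fun c _ => ?_
  rw [ρ.pd_pull c hs, Finset.mul_sum]
  refine Finset.sum_congr rfl fun d _ => ?_
  ring

end Calculus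

/-! ### Total derivatives -/

section TotalDerivatives

variable {B : JetCoord → Set ℝ}

/-- The components of the total derivative with respect to `t`. -/
def shiftT : JetCoord → DiffAlg B
  | .t => 1
  | .x => 0
  | .u i j => X (.u (i + 1) j)

/-- The components of the total derivative with respect to `x`. -/
def shiftX : JetCoord → DiffAlg B
  | .t => 0
  | .x => 1
  | .u i j => X (.u i (j + 1))

variable [IsBox B]

/-- The total derivative with respect to `t`. -/
def Dt : Derivation ℝ (DiffAlg B) (DiffAlg B) := V shiftT

/-- The total derivative with respect to `x`. -/
def Dx : Derivation ℝ (DiffAlg B) (DiffAlg B) := V shiftX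

theorem Dt_X (c : JetCoord) : Dt (X c : DiffAlg B) = shiftT c := V_X _ _

theorem Dx_X (c : JetCoord) : Dx (X c : DiffAlg B) = shiftX c := V_X _ _

theorem Dt_Dx (F : DiffAlg B) : Dt (Dx F) = Dx (Dt F) := by
  have h : (fun c => V shiftT (shiftX c) - V shiftX (shiftT c)) = fun _ => (0 : DiffAlg B) := by
    funext c
    cases c <;> simp [shiftT, shiftX, V_X]
  rw [Dt, Dx, V_comm, h, V_zero, add_zero]

theorem pd_V (c : JetCoord) (w : JetCoord → DiffAlg B) (F : DiffAlg B) :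
    pd c (V w F) = V w (pd c F) + V (fun d => pd c (w d)) F := by
  rw [← V_single, V_comm, V_single]
  congr 2
  congr 1
  funext d
  rw [V_single]
  split_ifs <;> simp

theorem pd_u_succ_Dx (i j : ℕ) (F : DiffAlg B) :
    pd (.u i (j + 1)) (Dx F) = Dx (pd (.u i (j + 1)) F) + pd (.u i j) F := by
  rw [Dx, pd_V, ← V_single (.u i j)]
  congr 2
  congr 1
  funext d
  cases d with
  | t => simp [shiftX]
  | x => simp [shiftX]
  | u i' j' =>
    by_cases h : JetCoord.u i' j' = .u i j
    · simp only [JetCoord.u.injEq] at h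
      simp [shiftX, h, pd_X_self]
    · rw [if_neg h]
      exact pd_X_of_ne fun e => h (by simpa [eq_comm] using e)

theorem pd_u_zero_Dx (i : ℕ) (F : DiffAlg B) : pd (.u i 0) (Dx F) = Dx (pd (.u i 0) F) := by
  rw [Dx, pd_V]
  have : (fun d => pd (.u i 0) (shiftX d)) = fun _ => (0 : DiffAlg B) := by
    funext d
    cases d <;> simp [shiftX, pd_X_of_ne]
  rw [this, V_zero, add_zero]

theorem pd_u_succ_Dt (i j : ℕ) (F : DiffAlg B) :
    pd (.u (i + 1) j) (Dt F) = Dt (pd (.u (i + 1) j) F) + pd (.u i j) F := by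
  rw [Dt, pd_V, ← V_single (.u i j)]
  congr 2
  congr 1
  funext d
  cases d with
  | t => simp [shiftT]
  | x => simp [shiftT]
  | u i' j' =>
    by_cases h : JetCoord.u i' j' = .u i j
    · simp only [JetCoord.u.injEq] at h
      simp [shiftT, h, pd_X_self]
    · rw [if_neg h]
      exact pd_X_of_ne fun e => h (by simpa [eq_comm] using e)

/-- The coordinates `t`, `x` and `∂ₜ^i ∂ₓ^j u` with `i, j < n`. -/
def uBlock (n : ℕ) : Finset JetCoord :=
  insert .t (insert .x ((Finset.range n ×ˢ Finset.range n).map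
    ⟨fun p : ℕ × ℕ => JetCoord.u p.1 p.2, fun p q h => by simpa [Prod.ext_iff] using h⟩))

theorem mem_uBlock_u {n i j : ℕ} : JetCoord.u i j ∈ uBlock n ↔ i < n ∧ j < n := by
  simp only [uBlock, Finset.mem_insert, reduceCtorEq, false_or, Finset.mem_map,
    Finset.mem_product, Finset.mem_range]
  constructor
  · rintro ⟨⟨a, b⟩, h, e⟩
    obtain ⟨rfl, rfl⟩ := JetCoord.u.inj e
    exact h
  · exact fun h => ⟨(i, j), h, rfl⟩

theorem sum_uBlock {M : Type*} [AddCommMonoid M] (w : JetCoord → M) (n : ℕ) :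
    ∑ c ∈ uBlock n, w c = w .t + (w .x
      + ∑ i ∈ Finset.range n, ∑ j ∈ Finset.range n, w (.u i j)) := by
  rw [uBlock, Finset.sum_insert (by simp), Finset.sum_insert (by simp), Finset.sum_map,
    Finset.sum_product]
  rfl

theorem exists_uBlock (F : DiffAlg B) : ∃ n₀, ∀ n, n₀ ≤ n → ∀ c ∉ uBlock n, pd c F = 0 := by
  obtain ⟨s, hs⟩ := exists_support F
  let b : JetCoord → ℕ := fun c => match c with
    | .u i j => i + j + 1
    | _ => 0
  refine ⟨s.sup b, fun n hn c hc => hs c fun h => hc ?_⟩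
  have hb : b c ≤ n := (Finset.le_sup h).trans hn
  cases c with
  | t => simp [uBlock]
  | x => simp [uBlock]
  | u i j =>
    have : i + j + 1 ≤ n := hb
    exact mem_uBlock_u.2 ⟨by omega, by omega⟩

theorem finsum_u_eq {F : DiffAlg B} {n : ℕ} (h : ∀ c ∉ uBlock n, pd c F = 0) {g : ℕ × ℕ → ℝ}
    (hg : ∀ p : ℕ × ℕ, pd (.u p.1 p.2) F = 0 → g p = 0) :
    ∑ᶠ p, g p = ∑ i ∈ Finset.range n, ∑ j ∈ Finset.range n, g (i, j) := by
  rw [← Finset.sum_product' _ _ fun i j => g (i, j)]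
  refine finsum_eq_sum_of_support_subset _ fun p hp => by_contra fun h' => hp (hg p (h _ ?_))
  rw [mem_uBlock_u]
  simpa using h'

theorem totalDt_eq {F : Jet → ℝ} {f : DiffAlg B} (h : ∀ z : jetDomain B, F z = f.1 z)
    (z : jetDomain B) : totalDt B F z = (Dt f).1 z := by
  obtain ⟨n, hn⟩ := exists_uBlock f
  have hpd : ∀ c, pderiv B c F z = (pd c f).1 z := fun c =>
    pderiv_congr (fun w hw => (h ⟨w, hw⟩).trans (ext_apply f hw).symm) c z.2
  rw [totalDt, Dt, V_eq_sum _ (hn n le_rfl), sum_uBlock, finsum_u_eq (hn n le_rfl)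
    fun p hp => by simp [hpd, hp]]
  simp [shiftT, X_apply, hpd]

theorem totalDx_eq {F : Jet → ℝ} {f : DiffAlg B} (h : ∀ z : jetDomain B, F z = f.1 z)
    (z : jetDomain B) : totalDx B F z = (Dx f).1 z := by
  obtain ⟨n, hn⟩ := exists_uBlock f
  have hpd : ∀ c, pderiv B c F z = (pd c f).1 z := fun c =>
    pderiv_congr (fun w hw => (h ⟨w, hw⟩).trans (ext_apply f hw).symm) c z.2
  rw [totalDx, Dx, V_eq_sum _ (hn n le_rfl), sum_uBlock, finsum_u_eq (hn n le_rfl)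
    fun p hp => by simp [hpd, hp]]
  simp [shiftX, X_apply, hpd]

theorem iterate_totalDt_eq {F : Jet → ℝ} {f : DiffAlg B} (h : ∀ z : jetDomain B, F z = f.1 z)
    (n : ℕ) : ∀ z : jetDomain B, (totalDt B)^[n] F z = (Dt^[n] f).1 z := by
  induction n with
  | zero => exact h
  | succ n ih =>
    intro z
    rw [Function.iterate_succ_apply', Function.iterate_succ_apply']
    exact totalDt_eq ih z

theorem iterate_totalDx_eq {F : Jet → ℝ} {f : DiffAlg B} (h : ∀ z : jetDomain B, F z = f.1 z)
    (n : ℕ) : ∀ z : jetDomain B, (totalDx B)^[n] F z = (Dx^[n] f).1 z := by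
  induction n with
  | zero => exact h
  | succ n ih =>
    intro z
    rw [Function.iterate_succ_apply', Function.iterate_succ_apply']
    exact totalDx_eq ih z

end TotalDerivatives

/-! ### The solution manifold of an evolution equation as a retract -/

/-- The derivatives of `u` that involve `t` are unrestricted. -/
class FreeTDerivs (B : JetCoord → Set ℝ) : Prop where
  eq_univ : ∀ i j, B (.u (i + 1) j) = Set.univ

/-- The number of `t`-derivatives in a coordinate. -/
def tord : JetCoord → ℕ
  | .u i _ => i
  | _ => 0

/-- The number of `x`-derivatives in a coordinate. -/
def xord : JetCoord → ℕ
  | .u _ j => j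
  | _ => 0

section Retraction

variable {B : JetCoord → Set ℝ} [IsBox B]

/-- `F` depends only on derivatives of `u` of order at most `n` in `t`. -/
def TOrderLE (n : ℕ) (F : DiffAlg B) : Prop := ∀ c, n < tord c → pd c F = 0

theorem TOrderLE.Dx {n : ℕ} {F : DiffAlg B} (hF : TOrderLE n F) : TOrderLE n (Dx F) := by
  intro c hc
  cases c with
  | t => simp [tord] at hc
  | x => simp [tord] at hc
  | u i j =>
    cases j with
    | zero => rw [pd_u_zero_Dx, hF _ hc, map_zero]
    | succ j => rw [pd_u_succ_Dx, hF _ hc, hF (.u i j) hc, map_zero, add_zero]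

theorem TOrderLE.Dt {n : ℕ} {F : DiffAlg B} (hF : TOrderLE n F) : TOrderLE (n + 1) (Dt F) := by
  intro c hc
  cases c with
  | t => simp [tord] at hc
  | x => simp [tord] at hc
  | u i j =>
    cases i with
    | zero => simp [tord] at hc
    | succ i =>
      have hi : n < tord (.u i j) := by simpa [tord] using hc
      rw [pd_u_succ_Dt, hF _ (by simp only [tord] at *; omega), hF _ hi, map_zero, add_zero]

/-- The differential function `∂ₜ^i ∂ₓ^j K`. -/
def dK (K : DiffAlg B) (i j : ℕ) : DiffAlg B := Dt^[i] (Dx^[j] K)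

theorem Dt_dK (K : DiffAlg B) (i j : ℕ) : Dt (dK K i j) = dK K (i + 1) j :=
  (Function.iterate_succ_apply' _ _ _).symm

theorem Dx_dK (K : DiffAlg B) (i j : ℕ) : Dx (dK K i j) = dK K i (j + 1) := by
  induction i with
  | zero =>
    change Dx (Dx^[j] K) = Dx^[j + 1] K
    exact (Function.iterate_succ_apply' _ _ _).symm
  | succ i ih => rw [← Dt_dK, ← Dt_dK, ← Dt_Dx, ih]

/-- Substitution commutes with a vector field as soon as it does so on the coordinates. -/
theorem V_pull_of_coord (ρ : Subst B) {w : JetCoord → DiffAlg B} {F : DiffAlg B} {n : ℕ}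
    (hF : TOrderLE n F) {v : JetCoord → DiffAlg B} (hv : ∀ c, tord c ≤ n → V w (ρ.comp c) = v c) :
    ∃ s : Finset JetCoord, (∀ c ∉ s, pd c F = 0) ∧
      V w (ρ.pull F) = ∑ c ∈ s, ρ.pull (pd c F) * v c := by
  obtain ⟨s, hs⟩ := exists_support F
  refine ⟨s, hs, ?_⟩
  rw [ρ.V_pull w hs]
  refine Finset.sum_congr rfl fun c _ => ?_
  by_cases h : tord c ≤ n
  · rw [hv c h]
  · rw [hF c (not_le.1 h), map_zero, zero_mul, zero_mul]

theorem iterate_X_sub (K : DiffAlg B) (i j : ℕ) :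
    Dt^[i] (Dx^[j] (X (.u 1 0) - K)) = X (.u (i + 1) j) - dK K i j := by
  induction i with
  | zero =>
    induction j with
    | zero => rfl
    | succ j ih =>
      have e : Dx^[j + 1] (X (.u 1 0) - K) = Dx (Dx^[j] (X (.u 1 0) - K)) :=
        Function.iterate_succ_apply' _ _ _
      simp only [Function.iterate_zero, id] at ih ⊢
      rw [e, ih, map_sub, Dx_dK, Dx_X]
      rfl
  | succ i ih =>
    rw [Function.iterate_succ_apply', ih, map_sub, Dt_dK, Dt_X]
    rfl

variable {K : DiffAlg B}

theorem tOrderLE_dK (hK : TOrderLE 0 K) (i j : ℕ) : TOrderLE i (dK K i j) := by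
  induction i with
  | zero =>
    induction j with
    | zero => exact hK
    | succ j ih => rw [← Dx_dK]; exact ih.Dx
  | succ i ih => rw [← Dt_dK]; exact ih.Dt

variable [hfree : FreeTDerivs B]

/-- The substitution that expresses the derivatives of `u` of order `1, …, n` in `t` through
those of order `0` by means of the differential consequences of `u_t = K`. -/
def elim (K : DiffAlg B) : ℕ → Subst B
  | 0 => ⟨X, fun c z => z.2 c⟩
  | n + 1 => ⟨fun c => if tord c = n + 1 then (elim K n).pull (dK K n (xord c))
      else (elim K n).comp c, fun c z => by
        by_cases h : tord c = n + 1
        · cases c with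
          | t => simp [tord] at h
          | x => simp [tord] at h
          | u i j =>
            obtain rfl : i = n + 1 := h
            rw [hfree.eq_univ]
            exact Set.mem_univ _
        · rw [if_neg h]
          exact (elim K n).mem c z⟩

theorem elim_comp_of_le (K : DiffAlg B) {n : ℕ} {c : JetCoord} (h : tord c ≤ n) :
    (elim K n).comp c = (elim K (tord c)).comp c := by
  induction n with
  | zero => rw [Nat.le_zero.1 h]
  | succ n ih =>
    rcases h.lt_or_eq with h | h
    · rw [← ih (by omega)]
      exact if_neg h.ne
    · rw [h]

/-- The substitution that eliminates all derivatives of `u` that involve `t`. The map it induces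
is a retraction of the jet domain onto the solution manifold of `u_t = K`. -/
def retr (K : DiffAlg B) : Subst B :=
  ⟨fun c => (elim K (tord c)).comp c, fun c => (elim K (tord c)).mem c⟩

theorem retr_pull_eq_elim (K : DiffAlg B) {n : ℕ} {F : DiffAlg B} (hF : TOrderLE n F) :
    (retr K).pull F = (elim K n).pull F :=
  DiffAlg.ext_pt fun z => eq_of_pd_eq_zero F _ _ fun c hc => hF c (by
    by_contra h
    refine hc ?_
    rw [Subst.map_apply, Subst.map_apply, elim_comp_of_le K (not_lt.1 h)]
    rfl)

theorem retr_pull_of_tOrderLE (K : DiffAlg B) {F : DiffAlg B} (hF : TOrderLE 0 F) :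
    (retr K).pull F = F := retr_pull_eq_elim K hF

theorem retr_comp_zero (K : DiffAlg B) {c : JetCoord} (hc : tord c = 0) :
    (retr K).comp c = X c := by
  change (elim K (tord c)).comp c = X c
  rw [hc]
  rfl

theorem retr_comp_succ (hK : TOrderLE 0 K) (i j : ℕ) :
    (retr K).comp (.u (i + 1) j) = (retr K).pull (dK K i j) := by
  rw [retr_pull_eq_elim K (tOrderLE_dK hK i j)]
  exact if_pos rfl

theorem tOrderLE_retr_comp (hK : TOrderLE 0 K) (n : ℕ) :
    ∀ c, tord c ≤ n → TOrderLE 0 ((retr K).comp c) := by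
  induction n with
  | zero =>
    intro c hc d hd
    rw [retr_comp_zero K (by omega)]
    exact pd_X_of_ne fun h => by subst h; omega
  | succ n ih =>
    intro c hc
    rcases hc.lt_or_eq with h | h
    · exact ih c (by omega)
    · cases c with
      | t => simp [tord] at h
      | x => simp [tord] at h
      | u i j =>
        obtain rfl : i = n + 1 := h
        intro d hd
        rw [retr_comp_succ hK, ← V_single]
        obtain ⟨s, -, hs⟩ := V_pull_of_coord (retr K) (tOrderLE_dK hK n j) (v := fun _ => 0)
          (w := fun e => if e = d then 1 else 0) fun c hc => by
            rw [V_single]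
            exact ih c hc d hd
        rw [hs]
        simp

theorem tOrderLE_retr_pull (hK : TOrderLE 0 K) (F : DiffAlg B) :
    TOrderLE 0 ((retr K).pull F) := by
  intro d hd
  obtain ⟨s, hs⟩ := exists_support F
  rw [(retr K).pd_pull d hs]
  refine Finset.sum_eq_zero fun c _ => ?_
  rw [tOrderLE_retr_comp hK (tord c) c le_rfl d hd, mul_zero]

theorem retr_pull_pull (hK : TOrderLE 0 K) (F : DiffAlg B) :
    (retr K).pull ((retr K).pull F) = (retr K).pull F :=
  retr_pull_of_tOrderLE K (tOrderLE_retr_pull hK F)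

theorem Dx_retr_comp (hK : TOrderLE 0 K) (n : ℕ) :
    ∀ c, tord c ≤ n → Dx ((retr K).comp c) = (retr K).pull (shiftX c) := by
  induction n with
  | zero =>
    intro c hc
    rw [retr_comp_zero K (by omega), Dx_X]
    cases c with
    | t => exact (map_zero _).symm
    | x => exact (map_one _).symm
    | u i j =>
      change X _ = (retr K).comp (.u i (j + 1))
      exact (retr_comp_zero K (c := .u i (j + 1)) (Nat.le_zero.1 hc)).symm
  | succ n ih =>
    intro c hc
    rcases hc.lt_or_eq with h | h
    · exact ih c (by omega)
    · cases c with
      | t => simp [tord] at h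
      | x => simp [tord] at h
      | u i j =>
        obtain rfl : i = n + 1 := h
        rw [retr_comp_succ hK]
        obtain ⟨s, hs0, hs⟩ := V_pull_of_coord (retr K) (w := shiftX) (tOrderLE_dK hK n j) ih
        rw [Dx, hs]
        change _ = (retr K).comp (.u (n + 1) (j + 1))
        rw [retr_comp_succ hK, ← Dx_dK, Dx, V_eq_sum _ hs0, map_sum]
        exact Finset.sum_congr rfl fun c _ => by rw [map_mul, mul_comm]

/-- The total derivative `D_x` is tangent to the solution manifold. -/
theorem Dx_retr_pull (hK : TOrderLE 0 K) (F : DiffAlg B) :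
    Dx ((retr K).pull F) = (retr K).pull (Dx F) := by
  obtain ⟨s, hs⟩ := exists_support F
  rw [Dx, (retr K).V_pull _ hs, V_eq_sum _ hs, map_sum]
  refine Finset.sum_congr rfl fun c _ => ?_
  rw [map_mul, mul_comm, ← Dx, Dx_retr_comp hK (tord c) c le_rfl]

theorem Dt_retr_comp (hK : TOrderLE 0 K) (n : ℕ) :
    ∀ c, tord c ≤ n → (retr K).pull (Dt ((retr K).comp c)) = (retr K).pull (shiftT c) := by
  induction n with
  | zero =>
    intro c hc
    rw [retr_comp_zero K (by omega), Dt_X]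
  | succ n ih =>
    intro c hc
    rcases hc.lt_or_eq with h | h
    · exact ih c (by omega)
    · cases c with
      | t => simp [tord] at h
      | x => simp [tord] at h
      | u i j =>
        obtain rfl : i = n + 1 := h
        rw [retr_comp_succ hK]
        obtain ⟨s, hs0, hs⟩ := V_pull_of_coord (retr K) (w := shiftT) (tOrderLE_dK hK n j)
          fun c _ => rfl
        rw [Dt, hs]
        change _ = (retr K).comp (.u (n + 1 + 1) j)
        rw [retr_comp_succ hK, ← Dt_dK, Dt, V_eq_sum _ hs0, map_sum, map_sum]
        refine Finset.sum_congr rfl fun c _ => ?_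
        rw [map_mul, map_mul, retr_pull_pull hK]
        by_cases h : tord c ≤ n
        · rw [← Dt, ih c h, mul_comm]
        · rw [tOrderLE_dK hK n j c (not_le.1 h)]
          simp

/-- The total derivative `D_t` is tangent to the solution manifold. -/
theorem retr_pull_Dt (hK : TOrderLE 0 K) (F : DiffAlg B) :
    (retr K).pull (Dt ((retr K).pull F)) = (retr K).pull (Dt F) := by
  obtain ⟨s, hs⟩ := exists_support F
  rw [Dt, (retr K).V_pull _ hs, V_eq_sum _ hs, map_sum, map_sum]
  refine Finset.sum_congr rfl fun c _ => ?_
  rw [map_mul, map_mul, retr_pull_pull hK, mul_comm, ← Dt, Dt_retr_comp hK (tord c) c le_rfl]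

/-- A differential function vanishes on the solution manifold of `u_t = K` exactly if eliminating
the derivatives that involve `t` turns it into zero. -/
theorem vanishes_iff (hK : TOrderLE 0 K) (F : DiffAlg B) :
    (∀ z, (∀ i j, (Dt^[i] (Dx^[j] (X (.u 1 0) - K))).1 z = 0) → F.1 z = 0) ↔
      (retr K).pull F = 0 := by
  constructor
  · intro h
    refine DiffAlg.ext_pt fun z => h ((retr K).map z) fun i j => ?_
    rw [iterate_X_sub, ← Subst.pull_apply, map_sub, Subst.pull_X, retr_comp_succ hK, sub_self]
    rfl
  · intro h z hz
    have hfix : ∀ n c, tord c ≤ n → ((retr K).map z).1 c = z.1 c := by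
      intro n
      induction n with
      | zero =>
        intro c hc
        rw [Subst.map_apply, retr_comp_zero K (by omega), X_apply]
      | succ n ih =>
        intro c hc
        rcases hc.lt_or_eq with h | h
        · exact ih c (by omega)
        · cases c with
          | t => simp [tord] at h
          | x => simp [tord] at h
          | u i j =>
            obtain rfl : i = n + 1 := h
            have e := hz n j
            rw [iterate_X_sub] at e
            rw [Subst.map_apply, retr_comp_succ hK, Subst.pull_apply,
              eq_of_pd_eq_zero (dK K n j) ((retr K).map z) z fun c hc =>
                tOrderLE_dK hK n j c (by_contra fun h => hc (ih c (not_lt.1 h)))]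
            exact (sub_eq_zero.1 e).symm
    have e : (retr K).map z = z := Subtype.ext (funext fun c => hfix (tord c) c le_rfl)
    have := congrArg (fun G : DiffAlg B => G.1 z) h
    rwa [Subst.pull_apply, e] at this

end Retraction

/-! ### Euler operators with respect to `x` and null divergences -/

section Euler

variable {B : JetCoord → Set ℝ} [IsBox B]

/-- The formal adjoint `-D_x` of `D_x`. -/
def adjDx : Module.End ℝ (DiffAlg B) := -(Dx : Derivation ℝ (DiffAlg B) (DiffAlg B)).toLinearMap

theorem adjDx_apply (F : DiffAlg B) : adjDx F = -Dx F := rfl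

theorem adjDx_pow_succ (j : ℕ) (F : DiffAlg B) : (adjDx ^ (j + 1)) F = (adjDx ^ j) (-Dx F) := by
  rw [pow_succ, Module.End.mul_apply, adjDx_apply]

/-- The Euler operator `∑ⱼ (-D_x)^j ∂/∂u_{i,j}` in the variable `x` alone, which treats the
`t`-derivatives of `u` as independent dependent variables. The sum is cut off at `j < N`; on a
given differential function, all large `N` give the same value. -/
def euler (i N : ℕ) (F : DiffAlg B) : DiffAlg B :=
  ∑ j ∈ Finset.range N, (adjDx ^ j) (pd (.u i j) F)

theorem euler_add (i N : ℕ) (F G : DiffAlg B) : euler i N (F + G) = euler i N F + euler i N G := by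
  simp only [euler, map_add, Finset.sum_add_distrib]

theorem adjDx_pow_Dt (j : ℕ) (F : DiffAlg B) : (adjDx ^ j) (Dt F) = Dt ((adjDx ^ j) F) := by
  induction j generalizing F with
  | zero => rfl
  | succ j ih => rw [adjDx_pow_succ, adjDx_pow_succ, ← Dt_Dx, ← map_neg, ih]

theorem euler_succ_Dt (i N : ℕ) (F : DiffAlg B) :
    euler (i + 1) N (Dt F) = Dt (euler (i + 1) N F) + euler i N F := by
  simp only [euler, pd_u_succ_Dt, map_add, adjDx_pow_Dt, map_sum, Finset.sum_add_distrib]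

/-- The sum `∑ⱼ (-D_x)^j (a ∂φ/∂u_{0,j})`, cut off at `j < N`: the adjoint of the linearization
of `φ` in the variables `u_{0,j}`, applied to `a`. -/
def adjLin (N : ℕ) (φ a : DiffAlg B) : DiffAlg B :=
  ∑ j ∈ Finset.range N, (adjDx ^ j) (a * pd (.u 0 j) φ)

/-- Integration by parts under the Euler operator: the terms `∂/∂u_{i,j-1}` of the commutators
`[∂/∂u_{i,j}, D_x]` telescope. -/
theorem sum_adjDx_pow_Dx (i N : ℕ) (a φ : DiffAlg B) (h : pd (.u i N) φ = 0) :
    ∑ j ∈ Finset.range (N + 1), (adjDx ^ j) (a * pd (.u i j) (Dx φ))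
      = ∑ j ∈ Finset.range (N + 1), (adjDx ^ j) (-Dx a * pd (.u i j) φ) := by
  have h0 : ∀ j, (adjDx ^ j) (a * Dx (pd (.u i j) φ))
      = (adjDx ^ j) (-Dx a * pd (.u i j) φ) - (adjDx ^ (j + 1)) (a * pd (.u i j) φ) := by
    intro j
    rw [adjDx_pow_succ, ← map_sub, Derivation.leibniz, smul_eq_mul, smul_eq_mul]
    congr 1
    ring
  have h1 : ∑ j ∈ Finset.range (N + 1), (adjDx ^ j) (a * pd (.u i j) (Dx φ))
      = ∑ j ∈ Finset.range (N + 1), (adjDx ^ j) (a * Dx (pd (.u i j) φ))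
        + ∑ j ∈ Finset.range N, (adjDx ^ (j + 1)) (a * pd (.u i j) φ) := by
    rw [Finset.sum_range_succ', Finset.sum_range_succ' (fun j => (adjDx ^ j)
      (a * Dx (pd (.u i j) φ)))]
    simp only [pd_u_succ_Dx, pd_u_zero_Dx, mul_add, map_add, Finset.sum_add_distrib]
    ring
  rw [h1]
  simp only [h0, Finset.sum_sub_distrib]
  rw [Finset.sum_range_succ (fun j => (adjDx ^ (j + 1)) (a * pd (.u i j) φ)), h]
  simp

theorem exists_adjLin_iterate (φ : DiffAlg B) (l : ℕ) : ∃ N₀, ∀ N, N₀ ≤ N → ∀ a,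
    adjLin N (Dx^[l] φ) a = adjLin N φ ((adjDx ^ l) a) := by
  induction l with
  | zero => exact ⟨0, fun N _ a => rfl⟩
  | succ l ih =>
    obtain ⟨N₀, h⟩ := ih
    obtain ⟨n, hn⟩ := exists_uBlock (Dx^[l] φ)
    refine ⟨N₀ + n + 1, fun N hN a => ?_⟩
    obtain ⟨N, rfl⟩ : ∃ N', N = N' + 1 := ⟨N - 1, by omega⟩
    rw [Function.iterate_succ_apply', adjLin, sum_adjDx_pow_Dx _ _ _ _
      (hn n le_rfl _ fun h => by have := (mem_uBlock_u.1 h).2; omega), adjDx_pow_succ]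
    exact h (N + 1) (by omega) (-Dx a)

/-- The Euler operators annihilate total `x`-derivatives. -/
theorem exists_euler_Dx (F : DiffAlg B) : ∃ N₀, ∀ N, N₀ ≤ N → ∀ i, euler i N (Dx F) = 0 := by
  obtain ⟨n, hn⟩ := exists_uBlock F
  refine ⟨n + 1, fun N hN i => ?_⟩
  obtain ⟨N, rfl⟩ : ∃ N', N = N' + 1 := ⟨N - 1, by omega⟩
  have := sum_adjDx_pow_Dx i N 1 F
    (hn n le_rfl _ fun h => by have := (mem_uBlock_u.1 h).2; omega)
  simpa [euler] using this

/-- The density of a null divergence is annihilated by all Euler operators: in order to see this,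
apply them to the divergence and descend in the number of `t`-derivatives. -/
theorem exists_euler_eq_zero_of_null {F G : DiffAlg B} (h : Dt F + Dx G = 0) :
    ∃ N₀, ∀ N, N₀ ≤ N → ∀ i, euler i N F = 0 := by
  obtain ⟨N₀, hG⟩ := exists_euler_Dx G
  obtain ⟨n, hn⟩ := exists_uBlock F
  refine ⟨N₀, fun N hN => ?_⟩
  have hlarge : ∀ i, n ≤ i → euler i N F = 0 := fun i hi => Finset.sum_eq_zero fun j _ => by
    rw [hn n le_rfl _ fun h => by have := (mem_uBlock_u.1 h).1; omega, map_zero]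
  have hstep : ∀ i, euler (i + 1) N F = 0 → euler i N F = 0 := by
    intro i hi
    have := congrArg (euler (i + 1) N) h
    rw [euler_add, hG N hN, euler_succ_Dt, hi, map_zero, zero_add, add_zero] at this
    rw [this]
    simp [euler]
  have hdesc : ∀ k i, n ≤ i + k → euler i N F = 0 := by
    intro k
    induction k with
    | zero => exact fun i hi => hlarge i hi
    | succ k ih => exact fun i hi => hstep i (ih (i + 1) (by omega))
  exact fun i => hdesc n i (by omega)

variable [FreeTDerivs B] {K : DiffAlg B}

theorem iterate_Dx_retr_comp (hK : TOrderLE 0 K) (i l : ℕ) :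
    (retr K).comp (.u i l) = Dx^[l] ((retr K).comp (.u i 0)) := by
  induction l with
  | zero => rfl
  | succ l ih =>
    rw [Function.iterate_succ_apply', ← ih, Dx_retr_comp hK i _ le_rfl]
    rfl

theorem adjDx_pow_retr_pull (hK : TOrderLE 0 K) (l : ℕ) (F : DiffAlg B) :
    (adjDx ^ l) ((retr K).pull F) = (retr K).pull ((adjDx ^ l) F) := by
  induction l generalizing F with
  | zero => rfl
  | succ l ih => rw [adjDx_pow_succ, adjDx_pow_succ, Dx_retr_pull hK, ← map_neg, ih]

/-- The restriction to the solution manifold of a function that all Euler operators annihilate is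
itself annihilated by the Euler operator in `u`: by the chain rule, the latter is a sum of adjoint
linearizations applied to restrictions of the former. -/
theorem exists_euler_retr_pull (hK : TOrderLE 0 K) {F : DiffAlg B}
    (hF : ∃ N₀, ∀ N, N₀ ≤ N → ∀ i, euler i N F = 0) :
    ∃ N₀, ∀ N, N₀ ≤ N → euler 0 N ((retr K).pull F) = 0 := by
  obtain ⟨N₁, hN₁⟩ := hF
  obtain ⟨n₀, hn₀⟩ := exists_uBlock F
  set n := max N₁ n₀
  have hn := hn₀ n (le_max_right _ _)
  choose M hM using fun i l => exists_adjLin_iterate ((retr K).comp (.u i 0)) l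
  refine ⟨(Finset.range n ×ˢ Finset.range n).sup fun p => M p.1 p.2, fun N hN => ?_⟩
  have hlin : ∀ i ∈ Finset.range n, ∀ l ∈ Finset.range n, ∀ a,
      adjLin N ((retr K).comp (.u i l)) a
        = adjLin N ((retr K).comp (.u i 0)) ((adjDx ^ l) a) := fun i hi l hl a => by
    rw [iterate_Dx_retr_comp hK i l]
    exact hM i l N ((Finset.le_sup (f := fun p : ℕ × ℕ => M p.1 p.2) (b := (i, l))
      (Finset.mk_mem_product hi hl)).trans hN) a
  have h1 : euler 0 N ((retr K).pull F)
      = ∑ c ∈ uBlock n, adjLin N ((retr K).comp c) ((retr K).pull (pd c F)) := by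
    simp only [euler, adjLin, (retr K).pd_pull _ hn, map_sum]
    exact Finset.sum_comm
  have hconst : ∀ c, tord c = 0 → (∀ j, c ≠ .u 0 j) → ∀ a,
      adjLin N ((retr K).comp c) a = 0 := fun c hc hcu a => Finset.sum_eq_zero fun j _ => by
    rw [retr_comp_zero K hc, pd_X_of_ne (hcu j).symm, mul_zero, map_zero]
  rw [h1, sum_uBlock, hconst .t rfl (by simp), hconst .x rfl (by simp), zero_add, zero_add]
  refine Finset.sum_eq_zero fun i hi => ?_
  rw [Finset.sum_congr rfl fun l hl => hlin i hi l hl _]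
  have h2 : ∑ l ∈ Finset.range n, adjLin N ((retr K).comp (.u i 0))
        ((adjDx ^ l) ((retr K).pull (pd (.u i l) F)))
      = adjLin N ((retr K).comp (.u i 0)) ((retr K).pull (euler i n F)) := by
    simp only [adjLin, euler, adjDx_pow_retr_pull hK, map_sum, Finset.sum_mul]
    exact Finset.sum_comm
  rw [h2, hN₁ n (le_max_left _ _) i]
  simp [adjLin]

end Euler

/-! ### Conserved vectors of the diffusion equation -/

section Diffusion

variable {B : JetCoord → Set ℝ}

/-- The data of the diffusion equation as elements of the differential algebra: `g = G(x)` with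
inverse `ginv`, `a = A(u)`, `w = W(t)` and antiderivatives `S`, `R`, `P` of `w`, `ginv`, `a`.
Nondegeneracy says that `a` is not a zero divisor, nonlinearity that `1` and `a` are linearly
independent over functions that do not involve `u`. -/
structure DiffusionData (B : JetCoord → Set ℝ) [IsBox B] where
  (g ginv a w S R P : DiffAlg B)
  pd_g : ∀ c, c ≠ .x → pd c g = 0
  g_mul_ginv : g * ginv = 1
  pd_a : ∀ c, c ≠ .u 0 0 → pd c a = 0
  pd_w : ∀ c, c ≠ .t → pd c w = 0
  pd_t_S : pd .t S = w
  pd_S : ∀ c, c ≠ .t → pd c S = 0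
  pd_x_R : pd .x R = ginv
  pd_R : ∀ c, c ≠ .x → pd c R = 0
  pd_u_P : pd (.u 0 0) P = a
  pd_P : ∀ c, c ≠ .u 0 0 → pd c P = 0
  eq_zero_of_a_mul : ∀ F, a * F = 0 → F = 0
  eq_zero_of_a_mul_add : ∀ F F', pd (.u 0 0) F = 0 → pd (.u 0 0) F' = 0 → a * F + F' = 0 →
    F = 0 ∧ F' = 0

theorem eq_zero_of_add_self {F : DiffAlg B} (h : F + F = 0) : F = 0 := by
  rw [← two_smul ℝ] at h
  simpa using h

variable [IsBox B]

theorem V_eq_of_u_free (w : JetCoord → DiffAlg B) {F : DiffAlg B}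
    (h : ∀ i j, (i, j) ≠ (0, 0) → pd (.u i j) F = 0) :
    V w F = w .t * pd .t F + (w .x * pd .x F + w (.u 0 0) * pd (.u 0 0) F) := by
  rw [V_eq_sum (s := {.t, .x, .u 0 0}) w]
  · rw [Finset.sum_insert (by simp), Finset.sum_insert (by simp), Finset.sum_singleton]
  · intro c hc
    cases c with
    | t => simp at hc
    | x => simp at hc
    | u i j => exact h i j fun e => hc (by simpa [Prod.ext_iff] using e)

theorem exists_const {F : DiffAlg B} (h : ∀ c, pd c F = 0) : ∃ r : ℝ, F = r • 1 := by
  choose b hb using range_nonempty (B := B)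
  refine ⟨F.1 ⟨b, hb⟩, DiffAlg.ext_pt fun z => ?_⟩
  rw [eq_of_pd_eq_zero F z ⟨b, hb⟩ fun c _ => h c]
  simp

namespace DiffusionData

variable (D : DiffusionData B)

/-- The flux `G A u_x`. -/
def flux : DiffAlg B := D.g * D.a * X (.u 0 1)

/-- The right-hand side of the equation solved for `u_t`. -/
def rhs : DiffAlg B := Dx D.flux + D.w

theorem tOrderLE_flux : TOrderLE 0 D.flux := by
  intro c hc
  have h1 : c ≠ .x := by rintro rfl; exact absurd hc (by simp [tord])
  have h2 : ∀ j, c ≠ .u 0 j := by rintro j rfl; exact absurd hc (by simp [tord])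
  simp [flux, Derivation.leibniz, D.pd_g c h1, D.pd_a c (h2 0), pd_X_of_ne (h2 1)]

theorem tOrderLE_rhs : TOrderLE 0 D.rhs := by
  intro c hc
  have h1 : c ≠ .t := by rintro rfl; exact absurd hc (by simp [tord])
  rw [rhs, map_add, D.tOrderLE_flux.Dx c hc, D.pd_w c h1, add_zero]

theorem pd_ga {m : ℕ} (hm : 1 ≤ m) : pd (.u 0 m) (D.g * D.a) = 0 := by
  simp [Derivation.leibniz, D.pd_g (.u 0 m) (by simp),
    D.pd_a (.u 0 m) (by simp only [ne_eq, JetCoord.u.injEq]; omega)]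

theorem pd_flux_one : pd (.u 0 1) D.flux = D.g * D.a := by
  rw [flux, Derivation.leibniz, D.pd_ga le_rfl, pd_X_self]
  simp

theorem pd_flux_of_two_le {m : ℕ} (hm : 2 ≤ m) : pd (.u 0 m) D.flux = 0 := by
  rw [flux, Derivation.leibniz, D.pd_ga (by omega),
    pd_X_of_ne (by simp only [ne_eq, JetCoord.u.injEq]; omega)]
  simp

theorem pd_rhs_succ (m : ℕ) : pd (.u 0 (m + 1)) D.rhs
    = Dx (pd (.u 0 (m + 1)) D.flux) + pd (.u 0 m) D.flux := by
  rw [rhs, map_add, pd_u_succ_Dx, D.pd_w _ (by simp), add_zero]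

theorem pd_dK_of_lt (j : ℕ) : ∀ m, j + 2 < m → pd (.u 0 m) (dK D.rhs 0 j) = 0 := by
  induction j with
  | zero =>
    intro m hm
    obtain ⟨m, rfl⟩ : ∃ k, m = k + 1 := ⟨m - 1, by omega⟩
    change pd (.u 0 (m + 1)) D.rhs = 0
    rw [pd_rhs_succ, D.pd_flux_of_two_le (by omega), D.pd_flux_of_two_le (by omega), map_zero,
      add_zero]
  | succ j ih =>
    intro m hm
    obtain ⟨m, rfl⟩ : ∃ k, m = k + 1 := ⟨m - 1, by omega⟩
    rw [← Dx_dK, pd_u_succ_Dx, ih _ (by omega), ih _ (by omega), map_zero, add_zero]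

/-- The top coefficient of `D_x^j` of the right-hand side is `G A`. -/
theorem pd_dK_top (j : ℕ) : pd (.u 0 (j + 2)) (dK D.rhs 0 j) = D.g * D.a := by
  induction j with
  | zero =>
    change pd (.u 0 2) D.rhs = _
    rw [pd_rhs_succ, D.pd_flux_of_two_le le_rfl, pd_flux_one, map_zero, zero_add]
  | succ j ih =>
    rw [← Dx_dK, pd_u_succ_Dx, ih, D.pd_dK_of_lt j _ (by omega), map_zero, zero_add]

theorem pd_Dx_ga {m : ℕ} (hm : 2 ≤ m) : pd (.u 0 m) (Dx (D.g * D.a)) = 0 := by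
  obtain ⟨m, rfl⟩ : ∃ k, m = k + 1 := ⟨m - 1, by omega⟩
  rw [pd_u_succ_Dx, D.pd_ga (by omega), D.pd_ga (by omega), map_zero, add_zero]

/-- `D_x^j` of the right-hand side is affine in `u_{j+1}`, except for `j = 0`. -/
theorem pd_pd_dK (j : ℕ) {m : ℕ} (hm : 2 ≤ m) :
    pd (.u 0 m) (pd (.u 0 (j + 1)) (dK D.rhs 0 j)) = 0 := by
  induction j with
  | zero =>
    change pd (.u 0 m) (pd (.u 0 1) D.rhs) = 0
    rw [pd_rhs_succ, pd_flux_one, map_add, D.pd_Dx_ga hm, pd_comm, D.pd_flux_of_two_le hm,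
      map_zero, add_zero]
  | succ j ih => rw [← Dx_dK, pd_u_succ_Dx, pd_dK_top, map_add, ih, D.pd_Dx_ga hm, add_zero]

/-- In contrast to its total `x`-derivatives, the right-hand side itself is quadratic in its
second highest derivative `u_x`. -/
theorem pd_one_pd_one_rhs : pd (.u 0 1) (pd (.u 0 1) D.rhs)
    = 2 * (D.g * pd (.u 0 0) D.a) := by
  have h1 : pd (.u 0 1) (pd (.u 0 0) D.flux) = D.g * pd (.u 0 0) D.a := by
    rw [pd_comm, pd_flux_one, Derivation.leibniz, D.pd_g _ (by simp)]
    simp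
  have h2 : pd (.u 0 0) (D.g * D.a) = D.g * pd (.u 0 0) D.a := by
    rw [Derivation.leibniz, D.pd_g _ (by simp)]
    simp
  rw [pd_rhs_succ, pd_flux_one, map_add, h1, pd_u_succ_Dx, D.pd_ga le_rfl, h2, map_zero]
  ring

theorem eq_zero_of_ga_mul {F : DiffAlg B} (h : D.g * D.a * F = 0) : F = 0 := by
  refine D.eq_zero_of_a_mul F ?_
  calc D.a * F = D.g * D.ginv * (D.a * F) := by rw [g_mul_ginv, one_mul]
    _ = D.ginv * (D.g * D.a * F) := by ring
    _ = 0 := by rw [h, mul_zero]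

/-- The density `u - ∫ W dt` of the first basic conserved vector, whose current is `-flux`. The
second one has the density `dens₁ * R` and the current `-flux * R + P`. -/
def dens₁ : DiffAlg B := X (.u 0 0) - D.S

theorem Dx_R : Dx D.R = D.ginv := by
  rw [Dx, V_eq_of_u_free _ fun i j _ => D.pd_R _ (by simp), D.pd_R _ (by simp),
    D.pd_R (.u 0 0) (by simp), D.pd_x_R]
  simp [shiftX]

theorem Dt_R : Dt D.R = 0 := by
  rw [Dt, V_eq_of_u_free _ fun i j _ => D.pd_R _ (by simp), D.pd_R _ (by simp),
    D.pd_R (.u 0 0) (by simp), D.pd_x_R]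
  simp [shiftT]

theorem Dt_S : Dt D.S = D.w := by
  rw [Dt, V_eq_of_u_free _ fun i j _ => D.pd_S _ (by simp), D.pd_S .x (by simp),
    D.pd_S (.u 0 0) (by simp), D.pd_t_S]
  simp [shiftT]

theorem Dx_P : Dx D.P = X (.u 0 1) * D.a := by
  rw [Dx, V_eq_of_u_free _ fun i j h => D.pd_P _ (by simpa [Prod.ext_iff] using h),
    D.pd_P .x (by simp), D.pd_P .t (by simp), D.pd_u_P]
  simp [shiftX]

theorem div₁ : Dt D.dens₁ + Dx (-D.flux) = X (.u 1 0) - D.rhs := by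
  rw [dens₁, map_sub, Dt_X, Dt_S, map_neg, rhs]
  simp only [shiftT]
  ring

theorem div₂ : Dt (D.dens₁ * D.R) + Dx (-D.flux * D.R + D.P) = (X (.u 1 0) - D.rhs) * D.R := by
  rw [← div₁, map_add, Derivation.leibniz, Derivation.leibniz, Dt_R, Dx_R, Dx_P]
  simp only [smul_eq_mul]
  have : D.flux * D.ginv = X (.u 0 1) * D.a := by
    calc D.flux * D.ginv = D.g * D.ginv * (X (.u 0 1) * D.a) := by rw [flux]; ring
      _ = _ := by rw [g_mul_ginv, one_mul]
  linear_combination -this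

section Order

variable {D} {T Y : DiffAlg B} {k : ℕ} (hTk : ∀ j, k < j → pd (.u 0 j) T = 0)
  (h : pd .t T + ∑ j ∈ Finset.range (k + 1), dK D.rhs 0 j * pd (.u 0 j) T + Dx Y = 0)

include hTk h

/-- Above the order of `T`, a derivative of the conservation equation hits only the factors
`D_x^j K` in the sum. -/
theorem pd_conservation_eq {m : ℕ} (hm : k < m) :
    ∑ j ∈ Finset.range (k + 1), pd (.u 0 j) T * pd (.u 0 m) (dK D.rhs 0 j)
      + pd (.u 0 m) (Dx Y) = 0 := by
  have h1 := congrArg (pd (.u 0 m)) h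
  rw [map_add, map_add, map_zero, pd_comm _ .t, hTk m hm, map_zero, zero_add, map_sum] at h1
  rw [← h1]
  congr 1
  refine Finset.sum_congr rfl fun j _ => ?_
  rw [Derivation.leibniz, pd_comm _ (.u 0 j) T, hTk m hm]
  simp

/-- If the density has order `k` in `x`, then the current has order at most `k + 1`: otherwise the
top derivative of `u` in `D_x Y` would have nothing to cancel with. -/
theorem pd_current_of_lt {m : ℕ} (hm : k + 1 < m) : pd (.u 0 m) Y = 0 := by
  obtain ⟨n, hn⟩ := exists_uBlock Y
  have hdesc : ∀ l m, k + 1 < m → n ≤ m + l → pd (.u 0 m) Y = 0 := by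
    intro l
    induction l with
    | zero =>
      intro m _ hm
      refine hn n le_rfl _ fun h => ?_
      have := (mem_uBlock_u.1 h).2
      omega
    | succ l ih =>
      intro m hm hl
      have h1 := pd_conservation_eq hTk h (m := m + 1) (by omega)
      rw [Finset.sum_eq_zero fun j hj => by
        rw [D.pd_dK_of_lt j (m + 1) (by have := Finset.mem_range.1 hj; omega), mul_zero],
        pd_u_succ_Dx, ih (m + 1) (by omega) (by omega)] at h1
      simpa using h1
  exact hdesc n m hm (by omega)

/-- Comparison of the coefficients of `u_{k+2}` in the conservation equation. -/
theorem pd_current_top : pd (.u 0 (k + 1)) Y = -(D.g * D.a * pd (.u 0 k) T) := by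
  have h1 := pd_conservation_eq hTk h (m := k + 2) (by omega)
  rw [Finset.sum_range_succ, Finset.sum_eq_zero fun j hj => by
    rw [D.pd_dK_of_lt j (k + 2) (by have := Finset.mem_range.1 hj; omega), mul_zero],
    pd_dK_top, pd_u_succ_Dx, pd_current_of_lt hTk h (by omega), map_zero] at h1
  linear_combination h1

/-- The density is affine in its top derivative: compare the coefficients of `u_{k+1}²`. -/
theorem pd_pd_density : pd (.u 0 k) (pd (.u 0 k) T) = 0 := by
  have hga : pd (.u 0 (k + 1)) (D.g * D.a) = 0 := D.pd_ga (by omega)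
  have hk1 : ∀ j, pd (.u 0 (k + 1)) (pd (.u 0 j) T) = 0 := fun j => by
    rw [pd_comm, hTk _ (by omega), map_zero]
  have htop := pd_current_top hTk h
  have htop' : pd (.u 0 (k + 1)) (pd (.u 0 (k + 1)) Y) = 0 := by
    rw [htop, map_neg, Derivation.leibniz, hga, hk1]
    simp
  have h1 := congrArg (pd (.u 0 (k + 1))) (pd_conservation_eq hTk h (m := k + 1) (by omega))
  rw [map_add, map_sum, map_zero, pd_u_succ_Dx, map_add, pd_u_succ_Dx, htop', map_zero, zero_add,
    pd_comm (.u 0 (k + 1)) (.u 0 k), htop, map_neg, Derivation.leibniz] at h1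
  simp only [Derivation.leibniz (pd (.u 0 (k + 1))), hk1, smul_eq_mul, mul_zero, add_zero] at h1
  have h2 : D.g * D.a * pd (.u 0 k) (pd (.u 0 k) T) = 0 := by
    rcases Nat.eq_zero_or_pos k with rfl | hk
    · simp only [zero_add, Finset.sum_range_one] at h1
      have e : pd (.u 0 1) (pd (.u 0 1) (dK D.rhs 0 0)) = _ := D.pd_one_pd_one_rhs
      rw [e, Derivation.leibniz, D.pd_g (.u 0 0) (by simp)] at h1
      simp only [smul_eq_mul, mul_zero, add_zero] at h1
      exact eq_zero_of_add_self (by linear_combination -h1)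
    · rw [D.pd_ga hk, Finset.sum_eq_zero] at h1
      · simp only [mul_zero, add_zero] at h1
        exact eq_zero_of_add_self (by linear_combination -h1)
      · intro j hj
        have hj := Finset.mem_range.1 hj
        rcases lt_trichotomy (j + 1) k with hjk | hjk | hjk
        · rw [D.pd_dK_of_lt j (k + 1) (by omega), map_zero, mul_zero]
        · subst hjk
          rw [pd_dK_top, D.pd_ga (by omega), mul_zero]
        · obtain rfl : j = k := by omega
          rw [D.pd_pd_dK j (by omega), mul_zero]
  exact D.eq_zero_of_ga_mul h2

end Order

variable [FreeTDerivs B]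

/-- Restriction to the solution manifold. -/
abbrev onSol : DiffAlg B →ₐ[ℝ] DiffAlg B := (retr D.rhs).pull

theorem onSol_eq : D.onSol (X (.u 1 0) - D.rhs) = 0 := by
  rw [map_sub, retr_pull_of_tOrderLE _ D.tOrderLE_rhs, Subst.pull_X,
    retr_comp_succ D.tOrderLE_rhs]
  exact sub_eq_zero.2 (retr_pull_of_tOrderLE _ D.tOrderLE_rhs)

/-- Conservation on the solution manifold, written in the coordinates `t`, `x`, `u_{0,j}`. -/
theorem conservation_eq {T Y : DiffAlg B} {k : ℕ} (hT : TOrderLE 0 T)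
    (hTk : ∀ j, k < j → pd (.u 0 j) T = 0) (hY : TOrderLE 0 Y)
    (h : D.onSol (Dt T + Dx Y) = 0) :
    pd .t T + ∑ j ∈ Finset.range (k + 1), dK D.rhs 0 j * pd (.u 0 j) T + Dx Y = 0 := by
  have hs : ∀ c ∉ (insert .t (insert .x ((Finset.range (k + 1)).image fun j => .u 0 j)) :
      Finset JetCoord), pd c T = 0 := by
    intro c hc
    cases c with
    | t => simp at hc
    | x => simp at hc
    | u i j =>
      rcases Nat.eq_zero_or_pos i with rfl | hi
      · refine hTk j (by_contra fun hj => hc ?_)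
        simp only [Finset.mem_insert, Finset.mem_image, Finset.mem_range]
        exact Or.inr (Or.inr ⟨j, by omega, rfl⟩)
      · exact hT _ hi
  rw [map_add, retr_pull_of_tOrderLE _ hY.Dx, Dt, V_eq_sum _ hs, Finset.sum_insert (by simp),
    Finset.sum_insert (by simp), Finset.sum_image (by simp)] at h
  simp only [shiftT, zero_mul, zero_add, one_mul, map_add, map_sum, map_mul, Subst.pull_X,
    retr_comp_succ D.tOrderLE_rhs] at h
  rw [retr_pull_of_tOrderLE (F := pd .t T) _ fun c hc => by rw [pd_comm, hT c hc, map_zero]] at h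
  rw [← h]
  congr 2
  refine Finset.sum_congr rfl fun j _ => ?_
  rw [retr_pull_of_tOrderLE _ (tOrderLE_dK D.tOrderLE_rhs 0 j),
    retr_pull_of_tOrderLE (F := pd (.u 0 j) T) _ fun c hc => by rw [pd_comm, hT c hc, map_zero]]

end DiffusionData

end Diffusion

/-! ### Reduction of conserved vectors and independence -/

section Reduction

variable {B : JetCoord → Set ℝ} [IsBox B]

namespace DiffusionData

variable (D : DiffusionData B)

theorem pd_dens₁_zero : pd (.u 0 0) D.dens₁ = 1 := by
  rw [dens₁, map_sub, pd_X_self, D.pd_S _ (by simp), sub_zero]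

theorem pd_dens₁_of_ne {c : JetCoord} (hc : c ≠ .t) (hc' : c ≠ .u 0 0) : pd c D.dens₁ = 0 := by
  rw [dens₁, map_sub, pd_X_of_ne hc', D.pd_S _ hc, sub_zero]

theorem pd_t_dens₁ : pd .t D.dens₁ = -D.w := by
  rw [dens₁, map_sub, pd_X_of_ne (by simp), D.pd_t_S, zero_sub]

theorem tOrderLE_dens₁ : TOrderLE 0 D.dens₁ := fun c hc => by
  refine D.pd_dens₁_of_ne ?_ ?_ <;> rintro rfl <;> simp [tord] at hc

theorem tOrderLE_R : TOrderLE 0 D.R := fun c hc => by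
  refine D.pd_R c ?_
  rintro rfl
  simp [tord] at hc

theorem tOrderLE_P : TOrderLE 0 D.P := fun c hc => by
  refine D.pd_P c ?_
  rintro rfl
  simp [tord] at hc

end DiffusionData

theorem TOrderLE.add {n : ℕ} {F F' : DiffAlg B} (hF : TOrderLE n F) (hF' : TOrderLE n F') :
    TOrderLE n (F + F') := fun c hc => by rw [map_add, hF c hc, hF' c hc, add_zero]

theorem TOrderLE.sub {n : ℕ} {F F' : DiffAlg B} (hF : TOrderLE n F) (hF' : TOrderLE n F') :
    TOrderLE n (F - F') := fun c hc => by rw [map_sub, hF c hc, hF' c hc, sub_zero]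

theorem TOrderLE.mul {n : ℕ} {F F' : DiffAlg B} (hF : TOrderLE n F) (hF' : TOrderLE n F') :
    TOrderLE n (F * F') := fun c hc => by rw [Derivation.leibniz, hF c hc, hF' c hc]; simp

theorem TOrderLE.smul {n : ℕ} (r : ℝ) {F : DiffAlg B} (hF : TOrderLE n F) :
    TOrderLE n (r • F) := fun c hc => by rw [Derivation.map_smul, hF c hc, smul_zero]

theorem TOrderLE.pd {n : ℕ} {F : DiffAlg B} (hF : TOrderLE n F) (d : JetCoord) :
    TOrderLE n (pd d F) := fun c hc => by rw [pd_comm, hF c hc, map_zero]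

theorem pd_u_eq_zero {F : DiffAlg B} (hF : TOrderLE 0 F) (h : ∀ j, 0 < j → pd (.u 0 j) F = 0)
    (i j : ℕ) (hij : (i, j) ≠ (0, 0)) : pd (.u i j) F = 0 := by
  rcases Nat.eq_zero_or_pos i with rfl | hi
  · exact h j (Nat.pos_of_ne_zero fun h => hij (by rw [h]))
  · exact hF _ hi

theorem Dx_eq_of_order_zero {F : DiffAlg B} (hF : TOrderLE 0 F)
    (h : ∀ j, 0 < j → pd (.u 0 j) F = 0) :
    Dx F = pd .x F + X (.u 0 1) * pd (.u 0 0) F := by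
  rw [Dx, V_eq_of_u_free _ (pd_u_eq_zero hF h)]
  simp [shiftX]

theorem Dt_eq_of_order_zero {F : DiffAlg B} (hF : TOrderLE 0 F)
    (h : ∀ j, 0 < j → pd (.u 0 j) F = 0) :
    Dt F = pd .t F + X (.u 1 0) * pd (.u 0 0) F := by
  rw [Dt, V_eq_of_u_free _ (pd_u_eq_zero hF h)]
  simp [shiftT]

namespace DiffusionData

variable (D : DiffusionData B)

/-- A function `al(t, x)` with `A(u) (G al_x)_x + al_t = 0` is a combination of `1` and `∫ dx/G`. -/
theorem exists_eq_of_multiplier {al : DiffAlg B} (hal : ∀ i j, pd (.u i j) al = 0)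
    (h : D.a * pd .x (D.g * pd .x al) + pd .t al = 0) :
    ∃ c₁ c₂ : ℝ, al = c₁ • 1 + c₂ • D.R ∧ D.g * pd .x al = c₂ • 1 := by
  have hg : ∀ i j, pd (.u i j) (D.g * pd .x al) = 0 := fun i j => by
    rw [Derivation.leibniz, D.pd_g _ (by simp), pd_comm, hal]
    simp
  obtain ⟨hx, ht⟩ := D.eq_zero_of_a_mul_add _ _ (by rw [pd_comm, hg, map_zero])
    (by rw [pd_comm, hal, map_zero]) h
  obtain ⟨c₂, hc₂⟩ := exists_const (F := D.g * pd .x al) fun c => by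
    cases c with
    | t =>
      rw [Derivation.leibniz, D.pd_g _ (by simp), pd_comm, ht]
      simp
    | x => exact hx
    | u i j => exact hg i j
  have halx : pd .x al = c₂ • D.ginv := by
    calc pd .x al = D.g * D.ginv * pd .x al := by rw [g_mul_ginv, one_mul]
      _ = D.ginv * (D.g * pd .x al) := by ring
      _ = c₂ • D.ginv := by rw [hc₂, mul_smul_comm, mul_one]
  obtain ⟨c₁, hc₁⟩ := exists_const (F := al - c₂ • D.R) fun c => by
    rw [map_sub, Derivation.map_smul]
    cases c with
    | t => rw [ht, D.pd_R _ (by simp), smul_zero, sub_zero]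
    | x => rw [halx, D.pd_x_R, sub_self]
    | u i j => rw [hal, D.pd_R _ (by simp), smul_zero, sub_zero]
  exact ⟨c₁, c₂, by rw [← hc₁, sub_add_cancel], hc₂⟩

variable [FreeTDerivs B]

/-- Modulo null divergences and vectors that vanish on the solution manifold, `(T, Y)` is a linear
combination of the two basic conserved vectors. -/
def IsSpanned (T Y : DiffAlg B) : Prop :=
  ∃ (c₁ c₂ : ℝ) (q₁ q₂ : DiffAlg B), Dt q₁ + Dx q₂ = 0 ∧
    D.onSol (T - (c₁ • D.dens₁ + c₂ • (D.dens₁ * D.R) + q₁)) = 0 ∧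
    D.onSol (Y - (c₁ • (-D.flux) + c₂ • (-D.flux * D.R + D.P) + q₂)) = 0

variable {D}

theorem IsSpanned.of_onSol {T Y : DiffAlg B} (h : D.IsSpanned (D.onSol T) (D.onSol Y)) :
    D.IsSpanned T Y := by
  obtain ⟨c₁, c₂, q₁, q₂, hq, h1, h2⟩ := h
  refine ⟨c₁, c₂, q₁, q₂, hq, ?_, ?_⟩
  · rwa [map_sub, retr_pull_pull D.tOrderLE_rhs, ← map_sub] at h1
  · rwa [map_sub, retr_pull_pull D.tOrderLE_rhs, ← map_sub] at h2

theorem IsSpanned.add_null {T Y p₁ p₂ : DiffAlg B} (h : D.IsSpanned T Y)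
    (hp : Dt p₁ + Dx p₂ = 0) : D.IsSpanned (T + p₁) (Y + p₂) := by
  obtain ⟨c₁, c₂, q₁, q₂, hq, h1, h2⟩ := h
  refine ⟨c₁, c₂, q₁ + p₁, q₂ + p₂, ?_, ?_, ?_⟩
  · rw [map_add, map_add]
    linear_combination hq + hp
  · rw [← h1]
    congr 1
    abel
  · rw [← h2]
    congr 1
    abel

/-- A conserved vector whose density is a function of `t`, `x` and `u` alone. -/
theorem isSpanned_of_order_zero {T Y : DiffAlg B} (hT : TOrderLE 0 T)
    (hT0 : ∀ j, 0 < j → pd (.u 0 j) T = 0) (hY : TOrderLE 0 Y)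
    (h : D.onSol (Dt T + Dx Y) = 0) : D.IsSpanned T Y := by
  have heq := D.conservation_eq hT hT0 hY h
  have hTuu := pd_pd_density hT0 heq
  have htop := pd_current_top hT0 heq
  rw [zero_add] at htop
  rw [zero_add, Finset.sum_range_one] at heq
  change pd .t T + D.rhs * pd (.u 0 0) T + Dx Y = 0 at heq
  set al := pd (.u 0 0) T with hal_def
  have hal0 : ∀ j, pd (.u 0 j) al = 0 := fun j => by
    rcases Nat.eq_zero_or_pos j with rfl | hj
    · exact hTuu
    · rw [hal_def, pd_comm, hT0 j hj, map_zero]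
  have halT : TOrderLE 0 al := hT.pd _
  have hal : ∀ i j, pd (.u i j) al = 0 := fun i j => by
    rcases Nat.eq_zero_or_pos i with rfl | hi
    · exact hal0 j
    · exact halT _ hi
  -- Removing the flux term leaves a current that does not involve `u_x` either.
  set Y₀ := Y + D.flux * al with hY₀_def
  have hY₀T : TOrderLE 0 Y₀ := hY.add (D.tOrderLE_flux.mul halT)
  have hY₀ : ∀ j, 0 < j → pd (.u 0 j) Y₀ = 0 := by
    intro j hj
    rw [hY₀_def, map_add, Derivation.leibniz, hal0]
    rcases Nat.lt_or_ge j 2 with hj2 | hj2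
    · obtain rfl : j = 1 := by omega
      rw [htop, pd_flux_one]
      simp only [smul_eq_mul]
      ring
    · rw [pd_current_of_lt hT0 (D.conservation_eq hT hT0 hY h) (by omega),
        D.pd_flux_of_two_le hj2]
      simp
  have hDxal : Dx al = pd .x al := by
    rw [Dx_eq_of_order_zero halT fun j _ => hal0 j, hal0, mul_zero, add_zero]
  have hdet : pd .x Y₀ + X (.u 0 1) * pd (.u 0 0) Y₀ + pd .t T + D.w * al
      - D.g * D.a * X (.u 0 1) * pd .x al = 0 := by
    rw [← Dx_eq_of_order_zero hY₀T hY₀, hY₀_def, map_add, Derivation.leibniz, hDxal]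
    simp only [smul_eq_mul]
    rw [rhs] at heq
    simp only [flux] at heq ⊢
    linear_combination heq
  -- The coefficient of `u_x`.
  have hYu : pd (.u 0 0) Y₀ = D.g * D.a * pd .x al := by
    have h1 := congrArg (pd (.u 0 1)) hdet
    have e1 : pd (.u 0 1) (pd .x Y₀) = 0 := by rw [pd_comm, hY₀ 1 one_pos, map_zero]
    have e2 : pd (.u 0 1) (pd (.u 0 0) Y₀) = 0 := by rw [pd_comm, hY₀ 1 one_pos, map_zero]
    have e3 : pd (.u 0 1) (pd .t T) = 0 := by rw [pd_comm, hT0 1 one_pos, map_zero]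
    have e4 : pd (.u 0 1) (pd .x al) = 0 := by rw [pd_comm, hal0, map_zero]
    simp only [map_add, map_sub, Derivation.leibniz, smul_eq_mul, map_zero, e1, e2, e3, e4,
      hal0, D.pd_w (.u 0 1) (by simp), D.pd_g (.u 0 1) (by simp), D.pd_a (.u 0 1) (by simp),
      pd_X_self] at h1
    linear_combination h1
  -- The remaining terms.
  have hrest : pd .x Y₀ + pd .t T + D.w * al = 0 := by
    rw [hYu] at hdet
    linear_combination hdet
  have hmult : D.a * pd .x (D.g * pd .x al) + pd .t al = 0 := by
    have h1 := congrArg (pd (.u 0 0)) hrest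
    have e1 : pd (.u 0 0) (pd .x Y₀) = D.a * pd .x (D.g * pd .x al) := by
      rw [pd_comm, hYu, mul_comm D.g, mul_assoc, Derivation.leibniz, D.pd_a .x (by simp)]
      simp
    have e2 : pd (.u 0 0) (D.w * al) = 0 := by
      rw [Derivation.leibniz, hal0, D.pd_w _ (by simp)]
      simp
    rwa [map_add, map_add, e1, e2, pd_comm _ .t, ← hal_def, map_zero, add_zero] at h1
  obtain ⟨c₁, c₂, hal_eq, hc₂⟩ := D.exists_eq_of_multiplier hal hmult
  -- What is left after subtracting the basic conserved vectors depends on `t` and `x` alone.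
  set q₁ := T - (c₁ • D.dens₁ + c₂ • (D.dens₁ * D.R)) with hq₁
  set q₂ := Y - (c₁ • (-D.flux) + c₂ • (-D.flux * D.R + D.P)) with hq₂
  have hq₂' : q₂ = Y₀ - c₂ • D.P := by
    rw [hq₂, hY₀_def, hal_eq]
    simp only [Algebra.smul_def]
    ring
  have hq₁T : TOrderLE 0 q₁ := hT.sub ((D.tOrderLE_dens₁.smul c₁).add
    ((D.tOrderLE_dens₁.mul D.tOrderLE_R).smul c₂))
  have hq₁0 : ∀ j, pd (.u 0 j) q₁ = 0 := by
    intro j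
    have hR : pd (.u 0 j) D.R = 0 := D.pd_R _ (by simp)
    simp only [hq₁, map_sub, map_add, Derivation.map_smul, Derivation.leibniz, hR]
    rcases Nat.eq_zero_or_pos j with rfl | hj
    · rw [pd_dens₁_zero, ← hal_def, hal_eq]
      simp
    · rw [hT0 j hj, D.pd_dens₁_of_ne (by simp)
        (by simp only [ne_eq, JetCoord.u.injEq]; omega)]
      simp
  have hq₂T : TOrderLE 0 q₂ := hq₂' ▸ hY₀T.sub (D.tOrderLE_P.smul c₂)
  have hq₂0 : ∀ j, pd (.u 0 j) q₂ = 0 := by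
    intro j
    rw [hq₂', map_sub, Derivation.map_smul]
    rcases Nat.eq_zero_or_pos j with rfl | hj
    · rw [hYu, D.pd_u_P]
      calc D.g * D.a * pd .x al - c₂ • D.a = D.a * (D.g * pd .x al) - c₂ • D.a := by ring
        _ = 0 := by rw [hc₂, mul_smul_comm, mul_one, sub_self]
    · rw [hY₀ j hj, D.pd_P _ (by simp only [ne_eq, JetCoord.u.injEq]; omega), smul_zero, sub_zero]
  refine ⟨c₁, c₂, q₁, q₂, ?_, ?_, ?_⟩
  · rw [Dt_eq_of_order_zero hq₁T fun j _ => hq₁0 j, Dx_eq_of_order_zero hq₂T fun j _ => hq₂0 j,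
      hq₁0, hq₂0, hq₂', hq₁]
    simp only [map_sub, map_add, Derivation.map_smul, Derivation.leibniz, D.pd_P .x (by simp),
      D.pd_R .t (by simp), pd_t_dens₁, smul_eq_mul, mul_zero, add_zero, zero_add, smul_zero,
      sub_zero]
    rw [hal_eq] at hrest
    simp only [Algebra.smul_def] at hrest ⊢
    linear_combination hrest
  · rw [hq₁, add_sub_cancel, sub_self, map_zero]
  · rw [hq₂, add_sub_cancel, sub_self, map_zero]

/-- Descent in the order of the density, which is affine in its top derivative `u_{k+1}`: if
`∂H/∂u_k` is the coefficient of `u_{k+1}`, then subtracting `D_x H` lowers the order. -/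
theorem isSpanned_of_order (k : ℕ) : ∀ T Y : DiffAlg B, TOrderLE 0 T →
    (∀ j, k < j → pd (.u 0 j) T = 0) → TOrderLE 0 Y → D.onSol (Dt T + Dx Y) = 0 →
    D.IsSpanned T Y := by
  induction k with
  | zero => exact fun T Y => isSpanned_of_order_zero
  | succ k ih =>
    intro T Y hT hTk hY h
    have htop := pd_pd_density hTk (D.conservation_eq hT hTk hY h)
    obtain ⟨H, hH, hHd⟩ := exists_antideriv (.u 0 k) (pd (.u 0 (k + 1)) T)
    have hHT : TOrderLE 0 H := fun c hc => hHd c (by rintro rfl; simp [tord] at hc)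
      (hT.pd _ c hc)
    have hHk : ∀ j, k < j → pd (.u 0 j) H = 0 := fun j hj => by
      refine hHd _ (by simp only [ne_eq, JetCoord.u.injEq]; omega) ?_
      rcases Nat.lt_or_ge (k + 1) j with hj' | hj'
      · rw [pd_comm, hTk j hj', map_zero]
      · obtain rfl : j = k + 1 := by omega
        exact htop
    have hred : D.IsSpanned (T - Dx H) (D.onSol (Y + Dt H)) := by
      refine ih _ _ (hT.sub hHT.Dx) (fun j hj => ?_) (tOrderLE_retr_pull D.tOrderLE_rhs _) ?_
      · obtain ⟨j, rfl⟩ : ∃ i, j = i + 1 := ⟨j - 1, by omega⟩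
        rw [map_sub, pd_u_succ_Dx, hHk _ (by omega), map_zero, zero_add]
        rcases Nat.lt_or_ge k j with hj' | hj'
        · rw [hTk _ (by omega), hHk _ hj', sub_zero]
        · obtain rfl : j = k := by omega
          rw [hH, sub_self]
      · have e : Dt (T - Dx H) + Dx (Y + Dt H) = Dt T + Dx Y := by
          rw [map_sub, map_add, Dt_Dx]
          ring
        rw [map_add, Dx_retr_pull D.tOrderLE_rhs, retr_pull_pull D.tOrderLE_rhs, ← map_add, e, h]
    have hred' : D.IsSpanned (T - Dx H) (Y + Dt H) := by
      refine IsSpanned.of_onSol ?_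
      rwa [retr_pull_of_tOrderLE (F := T - Dx H) _ (hT.sub hHT.Dx)]
    have := hred'.add_null (p₁ := Dx H) (p₂ := -Dt H) (by rw [map_neg, Dt_Dx, add_neg_cancel])
    simpa using this

theorem isSpanned_of_conserved {T Y : DiffAlg B} (h : D.onSol (Dt T + Dx Y) = 0) :
    D.IsSpanned T Y := by
  obtain ⟨n, hn⟩ := exists_uBlock (D.onSol T)
  refine IsSpanned.of_onSol (isSpanned_of_order n _ _ (tOrderLE_retr_pull D.tOrderLE_rhs _)
    (fun j hj => hn n le_rfl _ fun h => ?_) (tOrderLE_retr_pull D.tOrderLE_rhs _) ?_)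
  · have := (mem_uBlock_u.1 h).2
    omega
  · rw [map_add, retr_pull_Dt D.tOrderLE_rhs, Dx_retr_pull D.tOrderLE_rhs,
      retr_pull_pull D.tOrderLE_rhs, ← map_add, h]

/-- The two basic conserved vectors are linearly independent modulo trivial ones: the Euler
operator in `u` maps the combination of the densities to `c₁ + c₂ ∫ dx/G`, but annihilates the
restrictions of null divergences. -/
theorem eq_zero_of_trivial {c₁ c₂ : ℝ} {q₁ q₂ : DiffAlg B} (hq : Dt q₁ + Dx q₂ = 0)
    (h : D.onSol (c₁ • D.dens₁ + c₂ • (D.dens₁ * D.R) - q₁) = 0) : c₁ = 0 ∧ c₂ = 0 := by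
  obtain ⟨N, hN⟩ := exists_euler_retr_pull D.tOrderLE_rhs (exists_euler_eq_zero_of_null hq)
  have hv : TOrderLE 0 (c₁ • D.dens₁ + c₂ • (D.dens₁ * D.R)) :=
    (D.tOrderLE_dens₁.smul c₁).add ((D.tOrderLE_dens₁.mul D.tOrderLE_R).smul c₂)
  rw [map_sub, retr_pull_of_tOrderLE _ hv, sub_eq_zero] at h
  have h1 := hN (N + 1) (by omega)
  rw [← h, euler, Finset.sum_range_succ'] at h1
  have hR : ∀ j, pd (.u 0 j) D.R = 0 := fun j => D.pd_R _ (by simp)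
  have hj : ∀ j, pd (.u 0 (j + 1)) D.dens₁ = 0 := fun j => D.pd_dens₁_of_ne (by simp) (by simp)
  simp only [map_add, Derivation.map_smul, Derivation.leibniz, hR, hj, pd_dens₁_zero, smul_eq_mul, mul_zero,
    smul_zero, add_zero, map_zero, Finset.sum_const_zero, zero_add, pow_zero, mul_one,
    Module.End.one_apply] at h1
  have h2 := congrArg (pd .x) h1
  rw [map_add, Derivation.map_smul, Derivation.map_smul, Derivation.map_one_eq_zero, D.pd_x_R, smul_zero, zero_add,
    map_zero] at h2
  choose b hb using range_nonempty (B := B)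
  have hone : ∀ r : ℝ, r • (1 : DiffAlg B) = 0 → r = 0 := fun r hr => by
    have := congrArg (fun F : DiffAlg B => F.1 ⟨b, hb⟩) hr
    simpa using this
  have hc₂ : c₂ = 0 := hone c₂ (by
    rw [← D.g_mul_ginv, ← mul_smul_comm, h2, mul_zero])
  refine ⟨hone c₁ ?_, hc₂⟩
  rw [hc₂, zero_smul, add_zero] at h1
  exact h1

end DiffusionData

end Reduction

/-! ### Conservation laws in terms of the differential algebra -/

theorem contDiffOn_of_isAntideriv {P f : ℝ → ℝ} {s : Set ℝ} (hs : UniqueDiffOn ℝ s)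
    (hf : ContDiffOn ℝ ∞ f s) (h : IsAntideriv P f s) : ContDiffOn ℝ ∞ P s :=
  (contDiffOn_infty_iff_derivWithin hs).2 ⟨fun y hy => (h y hy).differentiableWithinAt,
    hf.congr fun y hy => (h y hy).derivWithin (hs y hy)⟩

section Bridge

variable {B : JetCoord → Set ℝ}

theorem isDiffFun_of_eq {F : Jet → ℝ} {f : DiffAlg B} (h : ∀ z : jetDomain B, F z = f.1 z) :
    IsDiffFun B F :=
  (isDiffFun_ext f).congr fun z hz => (h ⟨z, hz⟩).trans (ext_apply f hz).symm

variable [IsBox B] {F : (Jet → ℝ) × (Jet → ℝ)} {f₁ f₂ : DiffAlg B}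

theorem totalDiv_eq (h₁ : ∀ z : jetDomain B, F.1 z = f₁.1 z)
    (h₂ : ∀ z : jetDomain B, F.2 z = f₂.1 z) (z : jetDomain B) :
    totalDiv B F z = (Dt f₁ + Dx f₂).1 z := by
  rw [totalDiv, totalDt_eq h₁, totalDx_eq h₂]
  rfl

variable [FreeTDerivs B] {D : DiffusionData B} {E : Jet → ℝ}
  (hE : ∀ z : jetDomain B, E z = (X (.u 1 0) - D.rhs : DiffAlg B).1 z)

include hE

theorem vanishes_on_solManifold_iff {F : Jet → ℝ} {f : DiffAlg B}
    (h : ∀ z : jetDomain B, F z = f.1 z) : (∀ z ∈ solManifold B E, F z = 0) ↔ D.onSol f = 0 := by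
  have hiter := fun i j => iterate_totalDt_eq (iterate_totalDx_eq hE j) i
  rw [← vanishes_iff D.tOrderLE_rhs]
  constructor
  · intro hF z hz
    rw [← h]
    exact hF z ⟨z.2, fun i j => (hiter i j z).trans (hz i j)⟩
  · intro hf z hz
    rw [h ⟨z, hz.1⟩]
    exact hf ⟨z, hz.1⟩ fun i j => (hiter i j ⟨z, hz.1⟩).symm.trans (hz.2 i j)

theorem mem_CV_iff (h₁ : ∀ z : jetDomain B, F.1 z = f₁.1 z)
    (h₂ : ∀ z : jetDomain B, F.2 z = f₂.1 z) :
    F ∈ CV B E ↔ D.onSol (Dt f₁ + Dx f₂) = 0 := by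
  rw [← vanishes_on_solManifold_iff hE (totalDiv_eq h₁ h₂)]
  exact ⟨fun h => h.2.2, fun h => ⟨isDiffFun_of_eq h₁, isDiffFun_of_eq h₂, h⟩⟩

theorem mem_CV₀_iff {F : CV B E} (h₁ : ∀ z : jetDomain B, F.1.1 z = f₁.1 z)
    (h₂ : ∀ z : jetDomain B, F.1.2 z = f₂.1 z) :
    F ∈ CV₀ B E ↔ ∃ q₁ q₂ : DiffAlg B, Dt q₁ + Dx q₂ = 0 ∧ D.onSol (f₁ - q₁) = 0 ∧
      D.onSol (f₂ - q₂) = 0 := by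
  constructor
  · rintro ⟨P, Q, ⟨_, _, hP⟩, ⟨hQ₁, hQ₂, hQ⟩, hF⟩
    refine ⟨res Q.1 hQ₁, res Q.2 hQ₂, DiffAlg.ext_pt fun z => ?_, ?_, ?_⟩
    · rw [← totalDiv_eq (F := Q) (fun _ => rfl) (fun _ => rfl)]
      exact hQ z z.2
    · refine (vanishes_on_solManifold_iff hE (F := P.1) fun z => ?_).1 fun z hz => (hP z hz).1
      have : F.1.1 z = P.1 z + Q.1 z := by rw [hF]; rfl
      change _ = f₁.1 z - Q.1 z
      rw [← h₁, this, add_sub_cancel_right]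
    · refine (vanishes_on_solManifold_iff hE (F := P.2) fun z => ?_).1 fun z hz => (hP z hz).2
      have : F.1.2 z = P.2 z + Q.2 z := by rw [hF]; rfl
      change _ = f₂.1 z - Q.2 z
      rw [← h₂, this, add_sub_cancel_right]
  · rintro ⟨q₁, q₂, hq, hv₁, hv₂⟩
    have e₁ : ∀ z : jetDomain B, (F.1 - (ext q₁, ext q₂)).1 z = (f₁ - q₁).1 z := fun z => by
      change F.1.1 z - ext q₁ z = f₁.1 z - q₁.1 z
      rw [h₁, ext_apply q₁ z.2]
    have e₂ : ∀ z : jetDomain B, (F.1 - (ext q₁, ext q₂)).2 z = (f₂ - q₂).1 z := fun z => by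
      change F.1.2 z - ext q₂ z = f₂.1 z - q₂.1 z
      rw [h₂, ext_apply q₂ z.2]
    refine ⟨F.1 - (ext q₁, ext q₂), (ext q₁, ext q₂),
      ⟨isDiffFun_of_eq e₁, isDiffFun_of_eq e₂, fun z hz =>
        ⟨(vanishes_on_solManifold_iff hE e₁).2 hv₁ z hz,
          (vanishes_on_solManifold_iff hE e₂).2 hv₂ z hz⟩⟩,
      ⟨isDiffFun_ext q₁, isDiffFun_ext q₂, fun z hz => ?_⟩, (sub_add_cancel _ _).symm⟩
    rw [totalDiv_eq (f₁ := q₁) (f₂ := q₂) (fun z => ext_apply q₁ z.2) (fun z => ext_apply q₂ z.2)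
      ⟨z, hz⟩, hq]
    rfl

/-- Conserved vectors with the restrictions `(u - S, -G A u_x)` and
`((u - S) R, -G A u_x R + P)` to the jet domain represent a basis of the conservation laws. -/
theorem exists_basis {v₁ v₂ : (Jet → ℝ) × (Jet → ℝ)}
    (h₁₁ : ∀ z : jetDomain B, v₁.1 z = D.dens₁.1 z)
    (h₁₂ : ∀ z : jetDomain B, v₁.2 z = (-D.flux).1 z)
    (h₂₁ : ∀ z : jetDomain B, v₂.1 z = (D.dens₁ * D.R).1 z)
    (h₂₂ : ∀ z : jetDomain B, v₂.2 z = (-D.flux * D.R + D.P).1 z) :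
    ∃ (h₁ : v₁ ∈ CV B E) (h₂ : v₂ ∈ CV B E) (b : Module.Basis (Fin 2) ℝ (CL B E)),
      b 0 = CL.mk h₁ ∧ b 1 = CL.mk h₂ := by
  have h₁ : v₁ ∈ CV B E := (mem_CV_iff hE h₁₁ h₁₂).2 (by rw [D.div₁, D.onSol_eq])
  have h₂ : v₂ ∈ CV B E := (mem_CV_iff hE h₂₁ h₂₂).2 (by
    rw [D.div₂, map_mul, D.onSol_eq, zero_mul])
  have hcomb : ∀ c₁ c₂ : ℝ, c₁ • CL.mk h₁ + c₂ • CL.mk h₂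
      = Submodule.Quotient.mk (p := CV₀ B E) (c₁ • ⟨v₁, h₁⟩ + c₂ • ⟨v₂, h₂⟩) :=
    fun _ _ => rfl
  have hind : LinearIndependent ℝ ![CL.mk h₁, CL.mk h₂] := by
    refine LinearIndependent.pair_iff.2 fun c₁ c₂ h => ?_
    rw [hcomb, Submodule.Quotient.mk_eq_zero,
      mem_CV₀_iff hE (f₁ := c₁ • D.dens₁ + c₂ • (D.dens₁ * D.R))
        (f₂ := c₁ • (-D.flux) + c₂ • (-D.flux * D.R + D.P))
        (fun z => by
          change c₁ * v₁.1 z + c₂ * v₂.1 z = _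
          rw [h₁₁, h₂₁]
          rfl)
        (fun z => by
          change c₁ * v₁.2 z + c₂ * v₂.2 z = _
          rw [h₁₂, h₂₂]
          rfl)] at h
    obtain ⟨q₁, q₂, hq, hv, -⟩ := h
    exact DiffusionData.eq_zero_of_trivial hq hv
  have hspan : ⊤ ≤ Submodule.span ℝ (Set.range ![CL.mk h₁, CL.mk h₂]) := by
    rintro x -
    induction x using Submodule.Quotient.induction_on with | H F => ?_
    obtain ⟨c₁, c₂, q₁, q₂, hq, hv₁, hv₂⟩ := DiffusionData.isSpanned_of_conserved
      ((mem_CV_iff hE (f₁ := res F.1.1 F.2.1) (f₂ := res F.1.2 F.2.2.1)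
        (fun _ => rfl) (fun _ => rfl)).1 F.2)
    have hF : F - (c₁ • ⟨v₁, h₁⟩ + c₂ • ⟨v₂, h₂⟩) ∈ CV₀ B E := by
      refine (mem_CV₀_iff hE
        (f₁ := res F.1.1 F.2.1 - (c₁ • D.dens₁ + c₂ • (D.dens₁ * D.R)))
        (f₂ := res F.1.2 F.2.2.1 - (c₁ • (-D.flux) + c₂ • (-D.flux * D.R + D.P)))
        (fun z => ?_) (fun z => ?_)).2
        ⟨q₁, q₂, hq, by rwa [sub_sub], by rwa [sub_sub]⟩
      · change F.1.1 z - (c₁ * v₁.1 z + c₂ * v₂.1 z) = _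
        rw [h₁₁, h₂₁]
        rfl
      · change F.1.2 z - (c₁ * v₁.2 z + c₂ * v₂.2 z) = _
        rw [h₁₂, h₂₂]
        rfl
    rw [(Submodule.Quotient.eq _).2 hF, ← hcomb]
    exact Submodule.add_mem _
      (Submodule.smul_mem _ _ (Submodule.subset_span ⟨0, rfl⟩))
      (Submodule.smul_mem _ _ (Submodule.subset_span ⟨1, rfl⟩))
  exact ⟨h₁, h₂, Module.Basis.mk hind hspan, by simp, by simp⟩

end Bridge

section Range

variable {I J U : Set ℝ}

theorem isBox_range (hI : I.OrdConnected) (hI' : (interior I).Nonempty)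
    (hJ : J.OrdConnected) (hJ' : (interior J).Nonempty)
    (hU : U.OrdConnected) (hU' : (interior U).Nonempty) : IsBox (range I J U) where
  ordConnected c := by
    unfold range
    split
    exacts [hI, hJ, hU, Set.ordConnected_univ]
  interior_nonempty c := by
    unfold range
    split
    exacts [hI', hJ', hU', by simp]

instance : FreeTDerivs (range I J U) := ⟨fun _ _ => rfl⟩

theorem exists_diffusionData [IsBox (range I J U)] {G A W S R P : ℝ → ℝ}
    (hG : ContDiffOn ℝ ∞ G J) (hA : ContDiffOn ℝ ∞ A U) (hW : ContDiffOn ℝ ∞ W I)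
    (hG0 : ∀ x ∈ J, G x ≠ 0) (hA0 : U ⊆ closure {u ∈ U | A u ≠ 0})
    (hnonlinear : ¬ ∃ c : ℝ, ∀ u ∈ U, A u = c)
    (hS : IsAntideriv S W I) (hR : IsAntideriv R (fun x => 1 / G x) J)
    (hP : IsAntideriv P A U) :
    ∃ D : DiffusionData (range I J U), ∀ z : jetDomain (range I J U),
      D.g.1 z = G (z.1 .x) ∧ D.a.1 z = A (z.1 (.u 0 0)) ∧ D.w.1 z = W (z.1 .t) ∧
      D.S.1 z = S (z.1 .t) ∧ D.R.1 z = R (z.1 .x) ∧ D.P.1 z = P (z.1 (.u 0 0)) := by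
  have hG' : ContDiffOn ℝ ∞ (fun x => 1 / G x) J := contDiffOn_const.div hG hG0
  have hS' := contDiffOn_of_isAntideriv (uniqueDiffOn_range (B := range I J U) .t) hW hS
  have hR' := contDiffOn_of_isAntideriv (uniqueDiffOn_range (B := range I J U) .x) hG' hR
  have hP' := contDiffOn_of_isAntideriv (uniqueDiffOn_range (B := range I J U) (.u 0 0)) hA hP
  refine ⟨{
    g := fn .x G hG
    ginv := fn .x (fun x => 1 / G x) hG'
    a := fn (.u 0 0) A hA
    w := fn .t W hW
    S := fn .t S hS'
    R := fn .x R hR'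
    P := fn (.u 0 0) P hP'
    pd_g := fun c hc => pd_fn_of_ne hc _ _
    g_mul_ginv := DiffAlg.ext_pt fun z => mul_one_div_cancel (hG0 _ (z.2 .x))
    pd_a := fun c hc => pd_fn_of_ne hc _ _
    pd_w := fun c hc => pd_fn_of_ne hc _ _
    pd_t_S := pd_fn _ _ _ _ _ hS
    pd_S := fun c hc => pd_fn_of_ne hc _ _
    pd_x_R := pd_fn _ _ _ _ _ hR
    pd_R := fun c hc => pd_fn_of_ne hc _ _
    pd_u_P := pd_fn _ _ _ _ _ hP
    pd_P := fun c hc => pd_fn_of_ne hc _ _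
    eq_zero_of_a_mul := fun F hF => DiffAlg.ext_pt fun z => ?_
    eq_zero_of_a_mul_add := fun F F' hF hF' h => ?_ },
    fun z => ⟨rfl, rfl, rfl, rfl, rfl, rfl⟩⟩
  · -- By continuity in `u`, since `F` vanishes where `A` does not.
    have hu : z.1 (.u 0 0) ∈ U := z.2 (.u 0 0)
    have hcont := (hasDerivWithinAt_pd F z (.u 0 0)).continuousWithinAt.mono
      (Set.sep_subset U fun u => A u ≠ 0)
    have := mem_closure_iff_nhdsWithin_neBot.1 (hA0 hu)
    have h0 : Filter.Tendsto (fun r => ext F (Function.update z.1 (.u 0 0) r))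
        (nhdsWithin (z.1 (.u 0 0)) {u ∈ U | A u ≠ 0}) (nhds 0) := by
      refine tendsto_const_nhds.congr' ?_
      filter_upwards [self_mem_nhdsWithin] with r hr
      have hr' : r ∈ range I J U (.u 0 0) := hr.1
      rw [ext_update F z _ hr']
      have e := congrArg (fun H : DiffAlg (range I J U) => H.1 (upd z _ hr')) hF
      have e' : A r * F.1 (upd z _ hr') = 0 := by
        simpa [fn, upd] using e
      exact ((mul_eq_zero.1 e').resolve_left hr.2).symm
    have hlim := tendsto_nhds_unique hcont h0
    change ext F (Function.update z.1 _ (z.1 _)) = 0 at hlim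
    rwa [Function.update_eq_self, ext_apply F z.2] at hlim
  · obtain ⟨u₁, hu₁, u₂, hu₂, hne⟩ : ∃ u₁ ∈ U, ∃ u₂ ∈ U, A u₁ ≠ A u₂ := by
      by_contra! hc
      obtain ⟨u₀, hu₀⟩ := range_nonempty (B := range I J U) (.u 0 0)
      exact hnonlinear ⟨A u₀, fun u hu => hc u hu u₀ hu₀⟩
    have key : ∀ (z : jetDomain (range I J U)) (u : ℝ), u ∈ U →
        A u * F.1 z + F'.1 z = 0 := by
      intro z u hu
      have hu' : u ∈ range I J U (.u 0 0) := hu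
      have e := congrArg (fun H : DiffAlg (range I J U) => H.1 (upd z _ hu')) h
      have e' : A u * F.1 (upd z _ hu') + F'.1 (upd z _ hu') = 0 := by
        simpa [fn, upd] using e
      have hne : ∀ c, z.1 c ≠ (upd z _ hu').1 c → c = .u 0 0 := fun c hc =>
        by_contra fun h => hc (by simp [upd, h])
      rwa [← eq_of_pd_eq_zero F z _ fun c hc => by rw [hne c hc, hF],
        ← eq_of_pd_eq_zero F' z _ fun c hc => by rw [hne c hc, hF']] at e'
    have hF0 : ∀ z, F.1 z = 0 := fun z => by
      have e : (A u₁ - A u₂) * F.1 z = 0 := by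
        linear_combination key z u₁ hu₁ - key z u₂ hu₂
      exact (mul_eq_zero.1 e).resolve_left (sub_ne_zero.2 hne)
    refine ⟨DiffAlg.ext_pt hF0, DiffAlg.ext_pt fun z => ?_⟩
    have := key z u₁ hu₁
    rwa [hF0, mul_zero, zero_add] at this

end Range

end LocalCL

end

theorem theorem3 (I J U : Set ℝ)
    (hI : I.OrdConnected) (hI' : (interior I).Nonempty)
    (hJ : J.OrdConnected) (hJ' : (interior J).Nonempty)
    (hU : U.OrdConnected) (hU' : (interior U).Nonempty)
    (G A W : ℝ → ℝ)
    (hG : ContDiffOn ℝ ∞ G J) (hA : ContDiffOn ℝ ∞ A U) (hW : ContDiffOn ℝ ∞ W I)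
    (hG0 : ∀ x ∈ J, G x ≠ 0)
    (hA0 : U ⊆ closure {u ∈ U | A u ≠ 0})
    (hnonlinear : ¬ ∃ c : ℝ, ∀ u ∈ U, A u = c)
    (S R P : ℝ → ℝ)
    (hS : LocalCL.IsAntideriv S W I)
    (hR : LocalCL.IsAntideriv R (fun x => 1 / G x) J)
    (hP : LocalCL.IsAntideriv P A U) :
    Module.finrank ℝ (LocalCL.CL (LocalCL.range I J U)
      (LocalCL.diffusionEq (LocalCL.range I J U) G A W)) = 2 ∧
    ∃ (h₁ : LocalCL.vec₁ G A S ∈ LocalCL.CV (LocalCL.range I J U)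
        (LocalCL.diffusionEq (LocalCL.range I J U) G A W))
      (h₂ : LocalCL.vec₂ G A S R P ∈ LocalCL.CV (LocalCL.range I J U)
        (LocalCL.diffusionEq (LocalCL.range I J U) G A W))
      (b : Module.Basis (Fin 2) ℝ (LocalCL.CL (LocalCL.range I J U)
        (LocalCL.diffusionEq (LocalCL.range I J U) G A W))),
      b 0 = LocalCL.CL.mk h₁ ∧ b 1 = LocalCL.CL.mk h₂ := by
  have := LocalCL.isBox_range hI hI' hJ hJ' hU hU'
  obtain ⟨D, hD⟩ := LocalCL.exists_diffusionData hG hA hW hG0 hA0 hnonlinear hS hR hP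
  have hflux : ∀ z : LocalCL.jetDomain (LocalCL.range I J U),
      G (z.1 .x) * A (z.1 (.u 0 0)) * z.1 (.u 0 1) = D.flux.1 z := fun z => by
    obtain ⟨hg, ha, -⟩ := hD z
    rw [← hg, ← ha]
    rfl
  have hE : ∀ z : LocalCL.jetDomain (LocalCL.range I J U),
      LocalCL.diffusionEq (LocalCL.range I J U) G A W z
        = (LocalCL.X (.u 1 0) - D.rhs : LocalCL.DiffAlg _).1 z := fun z => by
    obtain ⟨-, -, hw, -⟩ := hD z
    rw [LocalCL.diffusionEq, LocalCL.totalDx_eq (f := D.flux) hflux, ← hw, sub_sub]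
    rfl
  obtain ⟨h₁, h₂, b, hb₁, hb₂⟩ := LocalCL.exists_basis hE
    (v₁ := LocalCL.vec₁ G A S) (v₂ := LocalCL.vec₂ G A S R P)
    (fun z => by
      obtain ⟨-, -, -, hs, -⟩ := hD z
      simp only [LocalCL.vec₁]
      rw [← hs]
      rfl)
    (fun z => by
      simp only [LocalCL.vec₁]
      rw [hflux]
      rfl)
    (fun z => by
      obtain ⟨-, -, -, hs, hr, -⟩ := hD z
      simp only [LocalCL.vec₂]
      rw [← hs, ← hr]
      rfl)
    (fun z => by
      obtain ⟨-, -, -, -, hr, hp⟩ := hD z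
      simp only [LocalCL.vec₂]
      rw [hflux, ← hr, ← hp]
      rfl)
  exact ⟨by rw [Module.finrank_eq_card_basis b, Fintype.card_fin], h₁, h₂, b, hb₁, hb₂⟩
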